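/- Maps are composed from left to right. Let $X$ be a (finite or infinite) set with at least two elements and $|X|\neq 3$. Let $Sing(X)$ be the semigroup of all maps $X\to X$ that are neither injective nor surjective (for finite $X$: all non-invertible maps). *Categories with subobjects.* A small category $\mathcal C$ with subobjects is equipped with a subcategory of *inclusions* $j(c,d)$ on all objects which is a partial order (written $c\subseteq d$), consists of monomorphisms of $\mathcal C$, and is such that if $f=hg$ with $f,g$ inclusions, then $h$ is an inclusion. A *retraction* is a right inverse of an inclusion. A *normal factorization* of $f$ is $f=euj$ with $e$ a retraction, $u$ an isomorphism and $j$ an inclusion; $f^\circ=eu$. A *cone* $\gamma$ with vertex $c_\gamma$ assigns to each object $c$ a morphism $\gamma(c):c\to c_\gamma$ with $j(c,c')\gamma(c')=\gamma(c)$ for $c\subseteq c'$; it is *normal* if some $\gamma(c)$ is an isomorphism. $\mathcal C$ is *normal* if every morphism has a normal factorization, every inclusion has a right inverse, and for each object $c$ there is a cone $\gamma$ with vertex $c$ and $\gamma(c)=1_c$. For $f:c_\gamma\to d$ let $(\gamma * f^\circ)(c)=\gamma(c)f^\circ$. The set $T\mathcal C$ of normal cones has the product $\gamma\cdot\sigma=\gamma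 * (\sigma(c_\gamma))^\circ$. *Normal dual.* For $\gamma\in T\mathcal C$ let $H(\gamma;-):\mathcal C\to\mathbf{Set}$ be given by $H(\gamma;c)=\{\gamma * f^\circ : f\in\mathcal C(c_\gamma,c)\}$ and $H(\gamma;g):\gamma * f^\circ\mapsto\gamma * (fg)^\circ$; its $M$-set is $MH(\gamma;-)=\{c:\gamma(c)\text{ is an isomorphism}\}$. The normal dual $N^*\mathcal C$ has as objects the functors $H(\epsilon;-)$ with $\epsilon\in T\mathcal C$ idempotent and as morphisms all natural transformations; its inclusions are the inclusions of subfunctors. *Cross-connections.* A *local isomorphism* is an inclusion preserving, fully faithful functor $F$ that, for each object $c$, restricts to an isomorphism from the full subcategory of the subobjects of $c$ onto that of the subobjects of $F(c)$. A *cross-connection* from $\mathcal D$ to $\mathcal C$ (normal categories) is a local isomorphism $\Gamma:\mathcal D\to N^*\mathcal C$ such that each object $c$ of $\mathcal C$ lies in $M\Gamma(d)$ for some $d$. A *dual* of $\Gamma$ is a cross-connection $\Delta$ from $\mathcal C$ to $\mathcal D$ such that $c\in M\Gamma(d)\iff d\in M\Delta(c)$ for all $c,d$. Put $\Gamma(c,d)=\Gamma(d)(c)$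 and $\Delta(c,d)=\Delta(c)(d)$; these are bifunctors $\mathcal C\times\mathcal D\to\mathbf{Set}$. A *duality* is a natural isomorphism $\chi:\Gamma(-,-)\to\Delta(-,-)$. Given $\Gamma,\Delta,\chi$, the *cross-connection semigroup* $\tilde S\Gamma$ consists of all pairs $(\gamma,\delta)$ of linked cones, i.e. those with $\gamma\in\Gamma(c,d)$ and $\delta=\chi(c,d)(\gamma)$ for some $(c,d)$, with operation $(\gamma,\delta)\circ(\gamma',\delta')=(\gamma\cdot\gamma',\delta'\cdot\delta)$. *The two categories.* $\mathscr P(X)$ has as objects the non-empty proper subsets of $X$, as morphisms all functions between them, and as inclusions the inclusion maps. $\Pi(X)$ has as objects the partitions of $X$ other than the partition into singletons; a morphism $\eta^*:\pi_1\to\pi_2$ is given by a map $\eta$ from the set of blocks of $\pi_2$ to the set of blocks of $\pi_1$, with $\eta^*\mu^*=(\mu\eta)^*$ for $\mu:\pi_3\to\pi_2$ (first $\mu$, then $\eta$); there is an inclusion $\nu^*:\pi_1\to\pi_2$ exactly when $\pi_2$ refines $\pi_1$, and $\nu$ then sends each block of $\pi_2$ to the block of $\pi_1$ containing it. Both are normal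 categories. **Statement.** Let $\Gamma$ be any cross-connection from $\Pi(X)$ to $\mathscr P(X)$. Then $\Gamma$ has a dual $\Delta$ together with a duality $\chi$; and for every dual $\Delta$ of $\Gamma$ and every duality $\chi$, the set $\tilde S\Gamma$ of linked pairs is closed under $\circ$, and $\tilde S\Gamma$ is a semigroup isomorphic to $Sing(X)$. -/

import Mathlib

open CategoryTheory

universe u

namespace CrossConnection

/-! ### Categories with subobjects and normal categories

Composition `f ≫ g` of morphisms is written from left to right. -/

/-- A (small) category with subobjects: a choice of a subcategory of inclusions which contains all
objects, has at most one morphism between two objects and is antisymmetric (a strict preorder).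
`SubobjOf c d` says that there is an inclusion from `c` to `d`, and `incl` is this inclusion. -/
class SubobjectCategory (C : Type u) [SmallCategory C] where
  SubobjOf : C → C → Prop
  refl (c : C) : SubobjOf c c
  trans {c d e : C} : SubobjOf c d → SubobjOf d e → SubobjOf c e
  antisymm {c d : C} : SubobjOf c d → SubobjOf d c → c = d
  incl {c d : C} : SubobjOf c d → (c ⟶ d)
  incl_refl (c : C) : incl (refl c) = 𝟙 c
  incl_trans {c d e : C} (h : SubobjOf c d) (k : SubobjOf d e) :
    incl h ≫ incl k = incl (trans h k)
  incl_mono {c d : C} (h : SubobjOf c d) : Mono (incl h)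
  /-- If `f = h g` with inclusions `f` and `g`, then `h` is an inclusion. -/
  incl_of_comp {c d e : C} (f : SubobjOf c e) (h : c ⟶ d) (g : SubobjOf d e) :
    incl f = h ≫ incl g → ∃ k : SubobjOf c d, h = incl k

open SubobjectCategory

section Normal

variable {C : Type u} [SmallCategory C] [SubobjectCategory C]

/-- A normal factorization `f = e u j`: a retraction `e` (a right inverse of an inclusion),
an isomorphism `u` and an inclusion `j`. -/
structure NormalFactorization {c d : C} (f : c ⟶ d) where
  c' : C
  d' : C
  hc : SubobjOf c' c
  hd : SubobjOf d' d
  e : c ⟶ c'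
  he : incl hc ≫ e = 𝟙 c'
  u : c' ≅ d'
  fac : e ≫ u.hom ≫ incl hd = f

/-- The epimorphic component `e u` does not depend on the choice of the normal factorization. -/
theorem epi_component_unique {c d : C} {f : c ⟶ d} (N N' : NormalFactorization f) :
    ∃ h : N.d' = N'.d', (N.e ≫ N.u.hom) ≫ eqToHom h = N'.e ≫ N'.u.hom := by
  have key : ∀ M M' : NormalFactorization f, SubobjOf M.d' M'.d' := by
    intro M M'
    have h : incl M.hd = (M.u.inv ≫ incl M.hc ≫ M'.e ≫ M'.u.hom) ≫ incl M'.hd := by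
      have h2 : incl M.hc ≫ f = M.u.hom ≫ incl M.hd := by
        have := congrArg (fun k => incl M.hc ≫ k) M.fac
        rw [← this, ← Category.assoc, M.he, Category.id_comp]
      simp only [Category.assoc]
      rw [M'.fac, h2, Iso.inv_hom_id_assoc]
    exact (incl_of_comp _ _ _ h).1
  have h : N.d' = N'.d' := antisymm (key N N') (key N' N)
  refine ⟨h, ?_⟩
  obtain ⟨c', d', hc, hd, e, he, u, fac⟩ := N
  obtain ⟨c₁, d₁, hc₁, hd₁, e₁, he₁, u₁, fac₁⟩ := N'
  obtain rfl : d' = d₁ := h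
  have := incl_mono hd
  rw [← cancel_mono (incl hd)]
  simp [fac, fac₁]

/-- A cone from the set of all objects to the vertex `d`. -/
def IsCone {d : C} (γ : ∀ c : C, c ⟶ d) : Prop :=
  ∀ (c c' : C) (h : SubobjOf c c'), incl h ≫ γ c' = γ c

variable (C) in
/-- Normal categories. A cone `γ` with vertex `c` and `γ c = 𝟙 c` is automatically normal. -/
class NormalCategory : Prop where
  factor {c d : C} (f : c ⟶ d) : Nonempty (NormalFactorization f)
  split {c d : C} (h : SubobjOf c d) : ∃ e : d ⟶ c, incl h ≫ e = 𝟙 c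
  cone (c : C) : ∃ γ : ∀ c' : C, c' ⟶ c, IsCone γ ∧ γ c = 𝟙 c

variable (C) in
/-- Normal cones: cones with some component an isomorphism. -/
structure NormalCone where
  vertex : C
  app (c : C) : c ⟶ vertex
  isCone : IsCone app
  exists_isIso : ∃ c : C, IsIso (app c)

variable [NormalCategory C]

/-- A chosen normal factorization of `f`. Its epimorphic component `e u` does not depend on the
choice, by `epi_component_unique`. -/
noncomputable def factorization {c d : C} (f : c ⟶ d) : NormalFactorization f :=
  (NormalCategory.factor f).some

/-- The codomain of the epimorphic component of `f`. -/
noncomputable abbrev image {c d : C} (f : c ⟶ d) : C := (factorization f).d'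

theorem image_sub {c d : C} (f : c ⟶ d) : SubobjOf (image f) d := (factorization f).hd

/-- The epimorphic component `f° = e u` of `f = e u j`. -/
noncomputable def epiComp {c d : C} (f : c ⟶ d) : c ⟶ image f :=
  (factorization f).e ≫ (factorization f).u.hom

theorem epiComp_incl {c d : C} (f : c ⟶ d) : epiComp f ≫ incl (image_sub f) = f := by
  rw [epiComp, Category.assoc]
  exact (factorization f).fac

/-- The normal cone `γ * f°`, with components `γ c ≫ f°`. -/
noncomputable def NormalCone.star (γ : NormalCone C) {d : C} (f : γ.vertex ⟶ d) :
    NormalCone C where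
  vertex := image f
  app c := γ.app c ≫ epiComp f
  isCone c c' h := by rw [← Category.assoc, γ.isCone c c' h]
  exists_isIso := by
    obtain ⟨c₀, h₀⟩ := γ.exists_isIso
    let F := factorization f
    let N := factorization (incl F.hc ≫ inv (γ.app c₀))
    refine ⟨N.d', ?_⟩
    let t : N.d' ⟶ F.c' := incl N.hd ≫ γ.app c₀ ≫ F.e
    have h1 : N.e ≫ N.u.hom ≫ t = 𝟙 _ := by
      have := N.fac
      simp only [t]
      rw [← Category.assoc N.u.hom, ← Category.assoc N.e, this]
      simp [F.he]
    have h2 : N.u.hom ≫ t = incl N.hc := by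
      rw [← Category.id_comp (N.u.hom ≫ t), ← N.he, Category.assoc, h1, Category.comp_id]
    have h3 : IsIso (N.u.hom ≫ t) := ⟨N.e, by rw [h2, N.he], h1⟩
    have h4 : IsIso t := IsIso.of_isIso_comp_left N.u.hom t
    have h5 : γ.app N.d' ≫ epiComp f = t ≫ F.u.hom := by
      rw [← γ.isCone _ _ N.hd]
      simp only [t, epiComp, Category.assoc]
      rfl
    rw [h5]
    exact IsIso.comp_isIso

/-- The product of normal cones, `γ · σ = γ * (σ(c_γ))°`; this makes the set of normal cones
the semigroup `TC`. -/
noncomputable instance : Mul (NormalCone C) where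
  mul γ σ := γ.star (σ.app γ.vertex)

/-- The morphism `f : c_γ ⟶ c` is determined by the cone `γ * f°`. -/
theorem NormalCone.star_injective (γ : NormalCone C) {c : C} {f g : γ.vertex ⟶ c}
    (h : γ.star f = γ.star g) : f = g := by
  obtain ⟨c₀, h₀⟩ := γ.exists_isIso
  have key : ∀ (σ τ : NormalCone C) (hσ : SubobjOf σ.vertex c) (hτ : SubobjOf τ.vertex c),
      σ = τ → σ.app c₀ ≫ incl hσ = τ.app c₀ ≫ incl hτ := by
    rintro σ τ hσ hτ rfl
    rfl
  have := key _ _ (image_sub f) (image_sub g) h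
  simp only [NormalCone.star, Category.assoc, epiComp_incl] at this
  exact (cancel_epi (γ.app c₀)).1 this

end Normal

/-! ### The normal dual -/

section Dual

variable (C : Type u) [SmallCategory C] [SubobjectCategory C]

/-- Set-valued functors on `C` all of whose values are sets of normal cones. -/
structure ConeFunctor where
  obj (c : C) : Set (NormalCone C)
  map {c d : C} (g : c ⟶ d) : obj c → obj d
  map_id (c : C) (x : obj c) : map (𝟙 c) x = x
  map_comp {c d e : C} (g : c ⟶ d) (h : d ⟶ e) (x : obj c) : map (g ≫ h) x = map h (map g x)

variable {C}

/-- A `ConeFunctor` as a functor to the category of sets. -/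
def ConeFunctor.toFunctor (F : ConeFunctor C) : C ⥤ Type u where
  obj c := F.obj c
  map g := TypeCat.ofHom (F.map g)
  map_id c := by ext x; simp [F.map_id]
  map_comp g h := by ext x; simp [F.map_comp]

/-- `F` is a subfunctor of `G`: all `F c` are subsets of `G c`, and the inclusion maps form a
natural transformation. -/
def ConeFunctor.IsSubfunctor (F G : ConeFunctor C) : Prop :=
  ∃ h : ∀ c, F.obj c ⊆ G.obj c, ∀ {c d : C} (g : c ⟶ d) (x : F.obj c),
    (F.map g x : NormalCone C) = G.map g ⟨x, h c x.2⟩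

theorem ConeFunctor.IsSubfunctor.antisymm {F G : ConeFunctor C} (h : F.IsSubfunctor G)
    (k : G.IsSubfunctor F) : F = G := by
  obtain ⟨h₁, h₂⟩ := h
  obtain ⟨k₁, -⟩ := k
  obtain ⟨F, Fm, Fi, Fc⟩ := F
  obtain ⟨G, Gm, Gi, Gc⟩ := G
  obtain rfl : F = G := funext fun c => Set.Subset.antisymm (h₁ c) (k₁ c)
  have : @Fm = @Gm := by
    funext c d g x
    exact Subtype.ext (h₂ g x)
  subst this
  rfl

/-- The inclusion of a subfunctor, as a natural transformation. -/
def ConeFunctor.IsSubfunctor.incl {F G : ConeFunctor C} (h : F.IsSubfunctor G) :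
    F.toFunctor ⟶ G.toFunctor where
  app c := TypeCat.ofHom (fun x : F.obj c => (⟨x, h.1 c x.2⟩ : G.obj c))
  naturality c d g := by
    ext x
    exact Subtype.ext (h.2 g x)

variable [NormalCategory C]

/-- The `H`-functor `H(γ; -)`: `H(γ; c) = {γ * f° : f ∈ C(c_γ, c)}` and `H(γ; g)` maps
`γ * f°` to `γ * (f g)°` (see `H_map_star`). -/
noncomputable def H (γ : NormalCone C) : ConeFunctor C where
  obj c := Set.range fun f : γ.vertex ⟶ c => γ.star f
  map g x := ⟨γ.star (x.2.choose ≫ g), _, rfl⟩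
  map_id c x := Subtype.ext (by simpa using x.2.choose_spec)
  map_comp {c d e} g h x := Subtype.ext (by
    generalize_proofs h₁ h₂ h₃
    have : h₃.choose = h₁.choose ≫ g := γ.star_injective h₃.choose_spec
    simp only [this, Category.assoc])

theorem H_map_star (γ : NormalCone C) {c d : C} (f : γ.vertex ⟶ c) (g : c ⟶ d) :
    ((H γ).map g ⟨γ.star f, f, rfl⟩ : NormalCone C) = γ.star (f ≫ g) := by
  simp only [H]
  generalize_proofs h
  rw [γ.star_injective h.choose_spec]

variable (C) in
/-- The objects of the normal dual `N*C`: the functors `H(ε; -)` for idempotent normal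
cones `ε`. -/
def NormalDual : Type u :=
  {F : ConeFunctor C // ∃ ε : NormalCone C, IsIdempotentElem ε ∧ F = H ε}

/-- The morphisms of `N*C` are all natural transformations. -/
instance : SmallCategory (NormalDual C) where
  Hom F G := F.1.toFunctor ⟶ G.1.toFunctor
  id F := 𝟙 F.1.toFunctor
  comp f g := NatTrans.vcomp f g

variable (C) in
/-- The embedding of the normal dual into the category of functors from `C` to sets. -/
def NormalDual.toFunctor : NormalDual C ⥤ C ⥤ Type u where
  obj F := F.1.toFunctor
  map f := f

/-- The inclusions of `N*C` are the inclusions of subfunctors. -/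
instance : SubobjectCategory (NormalDual C) where
  SubobjOf F G := F.1.IsSubfunctor G.1
  refl F := ⟨fun _ => subset_rfl, fun _ _ => rfl⟩
  trans := by
    rintro F G K ⟨h₁, h₂⟩ ⟨k₁, k₂⟩
    exact ⟨fun c => (h₁ c).trans (k₁ c), fun g x => (h₂ g x).trans (k₂ g ⟨x, h₁ _ x.2⟩)⟩
  antisymm h k := Subtype.ext (h.antisymm k)
  incl h := h.incl
  incl_refl F := by
    refine NatTrans.ext (funext fun c => ?_)
    ext x
    rfl
  incl_trans h k := by
    refine NatTrans.ext (funext fun c => ?_)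
    ext x
    rfl
  incl_mono {F G} h := by
    refine ⟨fun {K} a b hab => ?_⟩
    refine NatTrans.ext (funext fun c => ?_)
    ext x
    have := congrArg (fun t : K.1.toFunctor ⟶ G.1.toFunctor => t.app c x) hab
    exact Subtype.ext (congrArg (fun y : G.1.obj c => (y : NormalCone C)) this)
  incl_of_comp {F G K} f h g hfg := by
    have key : ∀ c (x : F.1.obj c),
        ((show G.1.obj c from h.app c x) : NormalCone C) = (x : NormalCone C) := by
      intro c x
      have := congrArg (fun t : F.1.toFunctor ⟶ K.1.toFunctor => t.app c x) hfg
      exact (congrArg (fun y : K.1.obj c => (y : NormalCone C)) this).symm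
    have hsub : ∀ c, F.1.obj c ⊆ G.1.obj c := by
      intro c x hx
      have := (h.app c (⟨x, hx⟩ : F.1.obj c) : G.1.obj c).2
      rwa [key c ⟨x, hx⟩] at this
    have happ : ∀ c (x : F.1.obj c), h.app c x = (⟨x, hsub c x.2⟩ : G.1.obj c) :=
      fun c x => Subtype.ext (key c x)
    refine ⟨⟨hsub, fun {c d} k x => ?_⟩, ?_⟩
    · have := congrArg (fun t => t x) (h.naturality k)
      have h2 : h.app d (F.1.map k x) = G.1.map k (h.app c x) := this
      rw [happ c x] at h2
      rw [← h2, key]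
    · refine NatTrans.ext (funext fun c => ?_)
      ext x
      exact happ c x

/-- The `M`-set of an `H`-functor: `M H(γ; -) = {c : γ c is an isomorphism}`. -/
def MSet (F : NormalDual C) : Set C :=
  {c | ∃ γ : NormalCone C, F.1 = H γ ∧ IsIso (γ.app c)}

end Dual

/-! ### Cross-connections -/

section Cross

/-- Local isomorphisms: inclusion preserving, fully faithful functors which restrict to an
isomorphism from each ideal `⟨c⟩` (the full subcategory of the subobjects of `c`) onto the ideal
`⟨F c⟩`; since `F` is fully faithful, the latter means that `F` is bijective on the objects of the
ideals. -/
structure IsLocalIso {C D : Type u} [SmallCategory C] [SubobjectCategory C]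
    [SmallCategory D] [SubobjectCategory D] (F : C ⥤ D) : Prop where
  map_incl {c c' : C} (h : SubobjOf c c') :
    ∃ h' : SubobjOf (F.obj c) (F.obj c'), F.map (incl h) = incl h'
  full : F.Full
  faithful : F.Faithful
  ideal (c : C) : Set.BijOn F.obj {c' | SubobjOf c' c} {d | SubobjOf d (F.obj c)}

variable {C D : Type u} [SmallCategory C] [SubobjectCategory C] [NormalCategory C]
  [SmallCategory D] [SubobjectCategory D] [NormalCategory D]

/-- `Γ` is a cross-connection from `D` to `C`. -/
structure IsCrossConnection (Γ : D ⥤ NormalDual C) : Prop where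
  isLocalIso : IsLocalIso Γ
  total (c : C) : ∃ d : D, c ∈ MSet (Γ.obj d)

/-- `Δ` is the dual cross-connection of `Γ`: a cross-connection from `C` to `D` such that
`c ∈ MΓ(d)` if and only if `d ∈ MΔ(c)`. -/
structure IsDualOf (Δ : C ⥤ NormalDual D) (Γ : D ⥤ NormalDual C) : Prop where
  isCrossConnection : IsCrossConnection Δ
  mem_MSet_iff (c : C) (d : D) : c ∈ MSet (Γ.obj d) ↔ d ∈ MSet (Δ.obj c)

/-- The bifunctor `Γ(-,-) : C × D ⥤ Set`, `Γ(c, d) = Γ(d)(c)`, of a functor `Γ : D ⥤ N*C`. -/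
def bifunctor (Γ : D ⥤ NormalDual C) : C × D ⥤ Type u :=
  Functor.uncurry.obj (Γ ⋙ NormalDual.toFunctor C).flip

/-- The bifunctor `Δ(-,-) : C × D ⥤ Set`, `Δ(c, d) = Δ(c)(d)`, of a functor `Δ : C ⥤ N*D`. -/
def dualBifunctor (Δ : C ⥤ NormalDual D) : C × D ⥤ Type u :=
  Functor.uncurry.obj (Δ ⋙ NormalDual.toFunctor D)

/-- `UΓ`, the union of all the sets `Γ(c, d)` of normal cones in `C`. -/
def U (Γ : D ⥤ NormalDual C) : Set (NormalCone C) := ⋃ (c : C) (d : D), (Γ.obj d).1.obj c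

/-- The map `χ(c, d) : Γ(c, d) → Δ(c, d)` of a natural isomorphism `χ`. -/
def component {Γ : D ⥤ NormalDual C} {Δ : C ⥤ NormalDual D} (χ : bifunctor Γ ≅ dualBifunctor Δ)
    (c : C) (d : D) (γ : (Γ.obj d).1.obj c) : (Δ.obj c).1.obj d :=
  χ.hom.app (c, d) γ

/-- The cone `γ` is linked to the cone `δ` by the natural isomorphism `χ`: there is `(c, d)` with
`γ ∈ Γ(c, d)` and `δ = χ(c, d)(γ)`. -/
def Linked {Γ : D ⥤ NormalDual C} {Δ : C ⥤ NormalDual D} (χ : bifunctor Γ ≅ dualBifunctor Δ)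
    (γ : NormalCone C) (δ : NormalCone D) : Prop :=
  ∃ (c : C) (d : D) (hγ : γ ∈ (Γ.obj d).1.obj c),
    δ = component χ c d ⟨γ, hγ⟩

/-- The underlying set of the cross-connection semigroup: all linked pairs of cones. Its operation
`(γ, δ) ∘ (γ', δ') = (γ · γ', δ' · δ)` is the one of `TC × (TD)ᵒᵖ`. -/
def linkedPairs {Γ : D ⥤ NormalDual C} {Δ : C ⥤ NormalDual D}
    (χ : bifunctor Γ ≅ dualBifunctor Δ) : Set (NormalCone C × (NormalCone D)ᵐᵒᵖ) :=
  {p | p.1 ∈ U Γ ∧ p.2.unop ∈ U Δ ∧ Linked χ p.1 p.2.unop}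

end Cross

/-! ### The powerset category -/

/-- Objects of the powerset category: the non-empty proper subsets of `X`. -/
@[ext]
structure Powerset (X : Type u) where
  carrier : Set X
  nonempty : carrier.Nonempty
  ne_univ : carrier ≠ Set.univ

variable {X : Type u}

/-- The morphisms of the powerset category are all functions. -/
instance : SmallCategory (Powerset X) where
  Hom A B := A.carrier → B.carrier
  id _ := id
  comp f g := g ∘ f

/-- Subobjects in the powerset category are subsets. -/
instance : SubobjectCategory (Powerset X) where
  SubobjOf A B := A.carrier ⊆ B.carrier
  refl _ := subset_rfl
  trans := Set.Subset.trans
  antisymm h k := Powerset.ext (Set.Subset.antisymm h k)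
  incl h := Set.inclusion h
  incl_refl _ := rfl
  incl_trans _ _ := rfl
  incl_mono h := ⟨fun a b hab => funext fun x => Set.inclusion_injective h (congrFun hab x)⟩
  incl_of_comp {A B D} f h g hfg := by
    have key : ∀ x : A.carrier, ((h x : B.carrier) : X) = x := fun x =>
      (congrArg Subtype.val (congrFun hfg x)).symm
    refine ⟨fun x hx => ?_, funext fun x => Subtype.ext (key x)⟩
    have := (h ⟨x, hx⟩ : B.carrier).2
    rwa [key ⟨x, hx⟩] at this

instance : NormalCategory (Powerset X) where
  factor {A B} f := by
    classical
    let f' : A.carrier → B.carrier := f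
    let s : Set.range f' → A.carrier := fun b => b.2.choose
    have hs : ∀ b, f' (s b) = b := fun b => b.2.choose_spec
    let A' : Powerset X :=
      { carrier := Set.range fun b => (s b : X)
        nonempty := by
          obtain ⟨a, ha⟩ := A.nonempty
          exact ⟨_, ⟨f' ⟨a, ha⟩, _, rfl⟩, rfl⟩
        ne_univ := fun h => A.ne_univ (Set.eq_univ_of_univ_subset (h ▸ by
          rintro _ ⟨b, rfl⟩
          exact (s b).2)) }
    let B' : Powerset X :=
      { carrier := Set.range fun a => (f' a : X)
        nonempty := by
          obtain ⟨a, ha⟩ := A.nonempty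
          exact ⟨_, ⟨a, ha⟩, rfl⟩
        ne_univ := fun h => B.ne_univ (Set.eq_univ_of_univ_subset (h ▸ by
          rintro _ ⟨b, rfl⟩
          exact (f' b).2)) }
    have hA : A'.carrier ⊆ A.carrier := by
      rintro _ ⟨b, rfl⟩
      exact (s b).2
    have hB : B'.carrier ⊆ B.carrier := by
      rintro _ ⟨b, rfl⟩
      exact (f' b).2
    have hinv : ∀ x : A'.carrier, (s ⟨f' ⟨x, hA x.2⟩, _, rfl⟩ : X) = x := by
      rintro ⟨_, b, rfl⟩
      have : f' ⟨(s b : X), (s b).2⟩ = b := hs b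
      simp [this]
    exact ⟨{
      c' := A'
      d' := B'
      hc := hA
      hd := hB
      e := fun a => (⟨s ⟨f' a, a, rfl⟩, _, rfl⟩ : A'.carrier)
      he := funext fun x => Subtype.ext (hinv x)
      u :=
        { hom := fun x => (⟨f' ⟨x, hA x.2⟩, _, rfl⟩ : B'.carrier)
          inv := fun y => (⟨s ⟨⟨y, hB y.2⟩, by
            obtain ⟨_, a, rfl⟩ := y
            exact ⟨a, rfl⟩⟩, _, rfl⟩ : A'.carrier)
          hom_inv_id := funext fun x => Subtype.ext (hinv x)
          inv_hom_id := funext fun y => by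
            have hy : (⟨y, hB y.2⟩ : B.carrier) ∈ Set.range f' := by
              obtain ⟨_, a, rfl⟩ := y
              exact ⟨a, rfl⟩
            have h := congrArg Subtype.val (hs ⟨_, hy⟩)
            exact Subtype.ext h }
      fac := funext fun a => hs ⟨f' a, a, rfl⟩ }⟩
  split {A B} h := by
    classical
    refine ⟨fun b => if hb : (b : X) ∈ A.carrier then ⟨b, hb⟩
      else ⟨A.nonempty.choose, A.nonempty.choose_spec⟩, funext fun a => ?_⟩
    exact dif_pos a.2
  cone D := by
    classical
    refine ⟨fun A b => if hb : (b : X) ∈ D.carrier then ⟨b, hb⟩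
      else ⟨D.nonempty.choose, D.nonempty.choose_spec⟩, fun A B h => rfl, funext fun a => ?_⟩
    exact dif_pos a.2

/-! ### The category of partitions -/

/-- Objects of the category of partitions: the non-identity partitions of `X`, given by the
corresponding equivalence relations. The blocks of the partition are the elements of
`Quotient rel`. -/
@[ext]
structure Partitions (X : Type u) where
  rel : Setoid X
  ne_bot : rel ≠ ⊥

/-- A morphism `η* : π₁ ⟶ π₂` is given by a map `η` from the blocks of `π₂` to the blocks of
`π₁`. (If `X` has at least two elements, then `η` is determined by the map `η* : α ↦ η α` from the
functions `π₁ → X` to the functions `π₂ → X`.) -/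
instance : SmallCategory (Partitions X) where
  Hom p q := Quotient q.rel → Quotient p.rel
  id _ := id
  comp f g := f ∘ g

/-- The map which sends a block of `r` to the block of the coarser partition `s` containing it. -/
def blockMap {r s : Setoid X} (h : r ≤ s) : Quotient r → Quotient s :=
  Quotient.map id fun _ _ hab => h hab

theorem blockMap_surjective {r s : Setoid X} (h : r ≤ s) : Function.Surjective (blockMap h) := by
  rintro ⟨x⟩
  exact ⟨Quotient.mk r x, rfl⟩

/-- `π₁` is a subobject of `π₂` when `π₂` refines `π₁`; the inclusion is `ν*`, where `ν` sends a
block of `π₂` to the block of `π₁` containing it. -/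
instance : SubobjectCategory (Partitions X) where
  SubobjOf p q := q.rel ≤ p.rel
  refl _ := le_rfl
  trans h k := le_trans k h
  antisymm h k := Partitions.ext (le_antisymm k h)
  incl h := blockMap h
  incl_refl _ := by
    funext x
    induction x using Quotient.inductionOn
    rfl
  incl_trans _ _ := by
    funext x
    induction x using Quotient.inductionOn
    rfl
  incl_mono h := ⟨fun a b hab => funext fun x => by
    obtain ⟨y, rfl⟩ := blockMap_surjective h x
    exact congrFun hab y⟩
  incl_of_comp {p q r} f h g hfg := by
    have key : ∀ x : X, Quotient.mk p.rel x = h (Quotient.mk q.rel x) := fun x =>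
      congrFun hfg (Quotient.mk r.rel x)
    have hle : q.rel ≤ p.rel := fun {x y} hxy => by
      apply Quotient.exact (s := p.rel)
      rw [key x, key y, Quotient.sound (s := q.rel) hxy]
    refine ⟨hle, funext fun x => ?_⟩
    induction x using Quotient.inductionOn with
    | h x => exact (key x).symm

instance : NormalCategory (Partitions X) where
  factor {p q} f := by
    classical
    let η : Quotient q.rel → Quotient p.rel := f
    have hne : Nonempty X := by
      by_contra hX
      rw [not_nonempty_iff] at hX
      exact p.ne_bot (Setoid.ext fun x => isEmptyElim x)
    obtain ⟨x₀⟩ := hne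
    -- `r` is a retraction of the blocks of `p` onto the image of `η`.
    let r : Quotient p.rel → Quotient p.rel := fun a =>
      if a ∈ Set.range η then a else η (Quotient.mk _ x₀)
    have hr : ∀ a, r a ∈ Set.range η := by
      intro a
      simp only [r]
      split_ifs with h
      · exact h
      · exact ⟨_, rfl⟩
    have hrη : ∀ a, r (η a) = η a := fun a => if_pos ⟨a, rfl⟩
    have hrr : ∀ a, r (r a) = r a := fun a => if_pos (hr a)
    let s : Setoid X := Setoid.ker fun x => r (Quotient.mk p.rel x)
    let t : Setoid X := Setoid.ker fun x => η (Quotient.mk q.rel x)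
    have hps : p.rel ≤ s := fun {x y} hxy =>
      congrArg r (Quotient.sound (s := p.rel) hxy)
    have hqt : q.rel ≤ t := fun {x y} hxy =>
      congrArg η (Quotient.sound (s := q.rel) hxy)
    let c' : Partitions X := ⟨s, fun h => p.ne_bot (le_bot_iff.1 (h ▸ hps))⟩
    let d' : Partitions X := ⟨t, fun h => q.ne_bot (le_bot_iff.1 (h ▸ hqt))⟩
    let e : Quotient s → Quotient p.rel :=
      Quotient.lift (fun x => r (Quotient.mk p.rel x)) fun _ _ h => h
    have he : ∀ x, e (blockMap hps x) = r x := by rintro ⟨x⟩; rfl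
    have he' : ∀ x, blockMap hps (e x) = x := by
      rintro ⟨x⟩
      change blockMap hps (r (Quotient.mk p.rel x)) = Quotient.mk s x
      obtain ⟨z, hz⟩ := Quotient.exists_rep (r (Quotient.mk p.rel x))
      rw [← hz]
      refine Quotient.sound (s := s) ?_
      change r (Quotient.mk p.rel z) = r (Quotient.mk p.rel x)
      rw [hz, hrr]
    let m : Quotient t → Quotient p.rel :=
      Quotient.lift (fun x => η (Quotient.mk q.rel x)) fun _ _ h => h
    have hm : ∀ x, m (blockMap hqt x) = η x := by rintro ⟨x⟩; rfl
    have hmr : ∀ x, r (m x) = m x := by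
      rintro ⟨x⟩
      exact hrη _
    have hminj : Function.Injective m := by
      rintro ⟨x⟩ ⟨y⟩ h
      exact Quotient.sound (s := t) h
    let g : Quotient p.rel → Quotient t := fun a => blockMap hqt (hr a).choose
    have hg : ∀ a, m (g a) = r a := fun a => (hm _).trans (hr a).choose_spec
    have hre : ∀ x, r (e x) = e x := by
      rintro ⟨x⟩
      exact hrr _
    exact ⟨{
      c' := c'
      d' := d'
      hc := hps
      hd := hqt
      e := e
      he := funext he'
      u :=
        { hom := fun x => blockMap hps (m x)
          inv := fun x => g (e x)
          hom_inv_id := funext fun x => by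
            change blockMap hps (m (g (e x))) = x
            rw [hg, hre, he']
          inv_hom_id := funext fun x => by
            change g (e (blockMap hps (m x))) = x
            apply hminj
            rw [hg, he, hrr, hmr] }
      fac := funext fun x => by
        change e (blockMap hps (m (blockMap hqt x))) = f x
        rw [he, hmr, hm] }⟩
  split {p q} h :=
    ⟨Function.surjInv (blockMap_surjective h),
      funext fun x => Function.surjInv_eq (blockMap_surjective h) x⟩
  cone p := by
    refine ⟨fun q a => Quotient.mk q.rel (Quotient.out a), fun q q' h => rfl, ?_⟩
    exact funext fun a => Quotient.out_eq a

/-! ### Singular transformations -/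

/-- The singular transformations of `X`: the maps which are neither injective nor surjective.
For finite `X` these are exactly the non-invertible maps, see `singular_iff_not_bijective`. -/
def Sing (X : Type u) : Type u :=
  {a : X → X // ¬ Function.Injective a ∧ ¬ Function.Surjective a}

/-- The product of transformations: `x (a b) = (x a) b`. -/
instance : Semigroup (Sing X) where
  mul a b := ⟨b.1 ∘ a.1, fun h => a.2.1 h.of_comp, fun h => b.2.2 h.of_comp⟩
  mul_assoc _ _ _ := rfl

theorem singular_iff_not_bijective [Finite X] (a : X → X) :
    (¬ Function.Injective a ∧ ¬ Function.Surjective a) ↔ ¬ Function.Bijective a := by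
  rw [Finite.injective_iff_surjective, and_self, ← Finite.surjective_iff_bijective]

end CrossConnection

/-!
A normal cone in `P(X)` is the family of restrictions of one singular transformation, its values
on the singletons. A normal cone in `Π(X)` is a family of threads of blocks, that is of choices of
one block in every partition which are compatible with refinement; if `X` has at least four
elements, then every thread is given by a point, so these cones are singular transformations
again, with the opposite product. Hence an object `H(ε; -)` of `N*P(X)` amounts to the partition
given by the kernel of `ε`, and an object of `N*Π(X)` to a subset.

Let `Γ` be a cross-connection and `⊤` the partition with one block. Morphisms `p ⟶ ⊤` are blocks
of `p`, and morphisms `Γ p ⟶ Γ ⊤` are evaluations of cones at points of `X`. For fixed `y` the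
preimages of the evaluations at `y` form a thread, so `Γ` carries the block of `f y` to the
evaluation at `y`, for a permutation `f` of `X`. The images of subsets under `f` give a dual, and
conjugation by `f` a duality. Conversely, since the `M`-sets consist of transversals, every dual
sends `A` to `f '' A`, and naturality along evaluations and constant cones shows that every
duality is conjugation by `f`. So the linked pairs form the graph of the anti-isomorphism
`a ↦ f a f⁻¹`, and projecting to the first component identifies them with `Sing(X)`.

If `X` has two elements, then `Π(X)` has a single object and a single morphism, and all pairs of
cones are linked.
-/

namespace CrossConnection

open SubobjectCategory

/-! ### Cones and the normal dual of a normal category -/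

section NormalDual

variable {C D : Type u} [SmallCategory C] [SubobjectCategory C] [SmallCategory D]
  [SubobjectCategory D]

theorem NormalCone.subobjOf_vertex {γ δ : NormalCone C} {d : C} (hγ : SubobjOf γ.vertex d)
    (hδ : SubobjOf δ.vertex d) (happ : ∀ c, γ.app c ≫ incl hγ = δ.app c ≫ incl hδ) :
    SubobjOf γ.vertex δ.vertex := by
  obtain ⟨c, _⟩ := γ.exists_isIso
  have h : incl hγ = (inv (γ.app c) ≫ δ.app c) ≫ incl hδ := by
    rw [Category.assoc, ← happ, IsIso.inv_hom_id_assoc]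
  exact (incl_of_comp _ _ _ h).1

theorem NormalCone.ext_of_app_incl {γ δ : NormalCone C} {d : C} (hγ : SubobjOf γ.vertex d)
    (hδ : SubobjOf δ.vertex d) (happ : ∀ c, γ.app c ≫ incl hγ = δ.app c ≫ incl hδ) : γ = δ := by
  have hvertex : γ.vertex = δ.vertex :=
    antisymm (subobjOf_vertex hγ hδ happ) (subobjOf_vertex hδ hγ fun c => (happ c).symm)
  obtain ⟨v, a, _, _⟩ := γ
  obtain ⟨w, b, _, _⟩ := δ
  obtain rfl : v = w := hvertex
  have := incl_mono hγ
  obtain rfl : a = b := funext fun c => (cancel_mono (incl hγ)).1 (happ c)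
  rfl

variable [NormalCategory C] [NormalCategory D]

theorem NormalCone.star_app_incl (γ : NormalCone C) {d : C} (f : γ.vertex ⟶ d) (c : C) :
    (γ.star f).app c ≫ incl (image_sub f) = γ.app c ≫ f := by
  simp only [NormalCone.star, Category.assoc, epiComp_incl]

theorem NormalCone.star_id (γ : NormalCone C) : γ.star (𝟙 γ.vertex) = γ :=
  ext_of_app_incl (image_sub _) (refl _) fun c => by rw [star_app_incl, incl_refl]

theorem NormalCone.star_comp (γ : NormalCone C) {c d : C} (f : γ.vertex ⟶ c) (g : c ⟶ d) :
    γ.star (f ≫ g) = (γ.star f).star (incl (image_sub f) ≫ g) :=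
  ext_of_app_incl (image_sub _) (image_sub _) fun b => by
    rw [star_app_incl, star_app_incl, ← Category.assoc, ← Category.assoc, star_app_incl]

theorem mem_H_self (γ : NormalCone C) : γ ∈ (H γ).obj γ.vertex :=
  ⟨𝟙 γ.vertex, γ.star_id⟩

namespace NormalDual

/-- An idempotent cone `ε` with `F = H(ε; -)`, see `eq_H`. -/
noncomputable def gen (F : NormalDual C) : NormalCone C := F.2.choose

theorem eq_H (F : NormalDual C) : F.1 = H F.gen := F.2.choose_spec.2

theorem gen_mem (F : NormalDual C) : F.gen ∈ F.1.obj F.gen.vertex := by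
  rw [congrArg (·.obj F.gen.vertex) F.eq_H]
  exact mem_H_self F.gen

variable {F G K : NormalDual C}

theorem subobjOf_vertex {c : C} (γ : F.1.obj c) : SubobjOf γ.1.vertex c := by
  obtain ⟨_, ε, -, rfl⟩ := F
  obtain ⟨_, f, rfl⟩ := γ
  exact image_sub f

theorem map_eq_star {c d : C} (g : c ⟶ d) (γ : F.1.obj c) :
    (F.1.map g γ : NormalCone C) = γ.1.star (incl (subobjOf_vertex γ) ≫ g) := by
  obtain ⟨_, ε, -, rfl⟩ := F
  obtain ⟨_, f, rfl⟩ := γ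
  rw [H_map_star, NormalCone.star_comp]

theorem subobjOf_iff_obj_subset : SubobjOf F G ↔ ∀ c, F.1.obj c ⊆ G.1.obj c :=
  ⟨fun h => h.1, fun h => ⟨h, fun g γ => by rw [map_eq_star, map_eq_star]⟩⟩

/-- The component at `c` of a morphism of the normal dual, as a map of sets of cones. -/
def appl (t : F ⟶ G) (c : C) (γ : F.1.obj c) : G.1.obj c := t.app c γ

theorem hom_ext {s t : F ⟶ G} (h : ∀ c γ, appl s c γ = appl t c γ) : s = t := by
  refine NatTrans.ext (funext fun c => ?_)
  ext γ
  exact h c γ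

theorem appl_comp (s : F ⟶ G) (t : G ⟶ K) (c : C) (γ : F.1.obj c) :
    appl (s ≫ t) c γ = appl t c (appl s c γ) := rfl

theorem appl_map (t : F ⟶ G) {c d : C} (g : c ⟶ d) (γ : F.1.obj c) :
    appl t d (F.1.map g γ) = G.1.map g (appl t c γ) :=
  congrArg (fun t => t γ) (t.naturality g)

theorem exists_map_gen_eq {c : C} (γ : F.1.obj c) :
    ∃ f : F.gen.vertex ⟶ c, F.1.map f ⟨F.gen, F.gen_mem⟩ = γ := by
  obtain ⟨f, hf⟩ : γ.1 ∈ (H F.gen).obj c := F.eq_H ▸ γ.2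
  refine ⟨f, Subtype.ext ?_⟩
  rw [map_eq_star, incl_refl, Category.id_comp]
  exact hf

theorem hom_ext_gen {s t : F ⟶ G}
    (h : appl s F.gen.vertex ⟨F.gen, F.gen_mem⟩ = appl t F.gen.vertex ⟨F.gen, F.gen_mem⟩) :
    s = t :=
  hom_ext fun c γ => by
    obtain ⟨f, rfl⟩ := exists_map_gen_eq γ
    rw [appl_map, appl_map, h]

/-- The morphism of the normal dual with the components `a`. -/
def homMk (a : ∀ c, F.1.obj c → G.1.obj c)
    (h : ∀ {c d : C} (g : c ⟶ d) γ, a d (F.1.map g γ) = G.1.map g (a c γ)) : F ⟶ G :=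
  show F.1.toFunctor ⟶ G.1.toFunctor from
  { app := fun c => TypeCat.ofHom (a c)
    naturality := fun c d g => by
      ext γ
      exact h g γ }

end NormalDual

variable {Γ : D ⥤ NormalDual C} {Δ : C ⥤ NormalDual D}

theorem component_map (χ : bifunctor Γ ≅ dualBifunctor Δ) {c c' : C} (g : c ⟶ c') (d : D)
    (γ : (Γ.obj d).1.obj c) :
    component χ c' d ((Γ.obj d).1.map g γ) =
      NormalDual.appl (Δ.map g) d (component χ c d γ) := by
  have hnat : component χ c' d (NormalDual.appl (Γ.map (𝟙 d)) c' ((Γ.obj d).1.map g γ)) =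
      (Δ.obj c').1.map (𝟙 d) (NormalDual.appl (Δ.map g) d (component χ c d γ)) :=
    congrArg (fun t => t γ)
      (χ.hom.naturality (X := (c, d)) (Y := (c', d)) (Prod.mkHom g (𝟙 d)))
  rwa [Γ.map_id, ConeFunctor.map_id] at hnat

theorem component_appl_map (χ : bifunctor Γ ≅ dualBifunctor Δ) (c : C) {d d' : D} (h : d ⟶ d')
    (γ : (Γ.obj d).1.obj c) :
    component χ c d' (NormalDual.appl (Γ.map h) c γ) =
      (Δ.obj c).1.map h (component χ c d γ) := by
  have hnat : component χ c d' (NormalDual.appl (Γ.map h) c ((Γ.obj d).1.map (𝟙 c) γ)) =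
      (Δ.obj c).1.map h (NormalDual.appl (Δ.map (𝟙 c)) d (component χ c d γ)) :=
    congrArg (fun t => t γ)
      (χ.hom.naturality (X := (c, d)) (Y := (c, d')) (Prod.mkHom (𝟙 c) h))
  rwa [Δ.map_id, ConeFunctor.map_id] at hnat

theorem mem_linkedPairs_iff {χ : bifunctor Γ ≅ dualBifunctor Δ}
    {x : NormalCone C × (NormalCone D)ᵐᵒᵖ} :
    x ∈ linkedPairs χ ↔
      ∃ (c : C) (d : D) (γ : (Γ.obj d).1.obj c), x = (γ.1, .op (component χ c d γ).1) := by
  constructor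
  · rintro ⟨-, -, c, d, hγ, hδ⟩
    exact ⟨c, d, ⟨x.1, hγ⟩, Prod.ext rfl (MulOpposite.unop_injective hδ)⟩
  · rintro ⟨c, d, γ, rfl⟩
    exact ⟨Set.mem_iUnion₂.2 ⟨c, d, γ.2⟩, Set.mem_iUnion₂.2 ⟨d, c, (component χ c d γ).2⟩,
      c, d, γ.2, rfl⟩

/-- The duality with the components `e`. -/
noncomputable def dualityMk (e : ∀ c d, (Γ.obj d).1.obj c ≃ (Δ.obj c).1.obj d)
    (h : ∀ {c c' : C} {d d' : D} (g : c ⟶ c') (k : d ⟶ d') (γ : (Γ.obj d).1.obj c),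
      e c' d' (NormalDual.appl (Γ.map k) c' ((Γ.obj d).1.map g γ)) =
        (Δ.obj c').1.map k (NormalDual.appl (Δ.map g) d (e c d γ))) :
    bifunctor Γ ≅ dualBifunctor Δ :=
  NatIso.ofComponents (fun x => (e x.1 x.2).toIso) fun {x y} k => by
    ext γ
    exact h k.1 k.2 γ

end NormalDual

section

variable {X : Type u}

/-! ### Transversals and singular transformations -/

/-- The set `A` is a transversal of the partition given by `s`: it meets every block in exactly one
point. -/
def IsTransversal (s : Setoid X) (A : Set X) : Prop :=
  ∀ x, ∃! a, a ∈ A ∧ s a x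

theorem IsTransversal.eq_of_rel {s : Setoid X} {A : Set X} (h : IsTransversal s A) {a b : X}
    (ha : a ∈ A) (hb : b ∈ A) (hab : s a b) : a = b :=
  (h b).unique ⟨ha, hab⟩ ⟨hb, s.refl b⟩

theorem IsTransversal.eq_bot_iff {s : Setoid X} {A : Set X} (h : IsTransversal s A) :
    s = ⊥ ↔ A = Set.univ := by
  constructor
  · rintro rfl
    refine Set.eq_univ_of_forall fun x => ?_
    obtain ⟨a, ⟨ha, rfl⟩, -⟩ := h x
    exact ha
  · rintro rfl
    exact le_bot_iff.1 fun x y => h.eq_of_rel (Set.mem_univ x) (Set.mem_univ y)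

theorem isTransversal_ker_range {e : X → X} (he : ∀ x, e (e x) = e x) :
    IsTransversal (Setoid.ker e) (Set.range e) := by
  refine fun x => ⟨e x, ⟨⟨x, rfl⟩, he x⟩, ?_⟩
  rintro _ ⟨⟨y, rfl⟩, hyx⟩
  exact (he y).symm.trans hyx

theorem injective_iff_surjective_of_idempotent {e : X → X} (he : ∀ x, e (e x) = e x) :
    Function.Injective e ↔ Function.Surjective e := by
  rw [Setoid.injective_iff_ker_bot, ← Set.range_eq_univ, (isTransversal_ker_range he).eq_bot_iff]

theorem Partitions.exists_ne_rel (p : Partitions X) : ∃ a b, a ≠ b ∧ p.rel a b := by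
  by_contra! h
  refine p.ne_bot (le_bot_iff.1 fun x y hxy => ?_)
  by_contra hne
  exact h x y hne hxy

/-- The kernel of a singular transformation, as an object of `Π(X)`. -/
def Sing.ker (a : Sing X) : Partitions X where
  rel := Setoid.ker a.1
  ne_bot h := a.2.1 ((Setoid.injective_iff_ker_bot _).2 h)

/-- The range of a singular transformation, as an object of `P(X)`. -/
def Sing.range (a : Sing X) : Powerset X where
  carrier := Set.range a.1
  nonempty := by
    obtain ⟨x, -, -⟩ := a.ker.exists_ne_rel
    exact ⟨a.1 x, x, rfl⟩
  ne_univ h := a.2.2 (Set.range_eq_univ.1 h)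

theorem Sing.isTransversal_of_isIdempotentElem {e : Sing X} (he : IsIdempotentElem e) :
    IsTransversal e.ker.rel e.range.carrier :=
  isTransversal_ker_range fun x => congrFun (congrArg Subtype.val he) x

theorem Partitions.exists_isIdempotentElem_ker_eq (p : Partitions X) :
    ∃ e : Sing X, IsIdempotentElem e ∧ e.ker = p := by
  let e (x : X) : X := (Quotient.mk p.rel x).out
  have he (x) : e (e x) = e x := congrArg Quotient.out (Quotient.out_eq _)
  have hker : Setoid.ker e = p.rel := Setoid.ext fun x y =>
    Quotient.out_injective.eq_iff.trans Quotient.eq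
  have hinj : ¬ Function.Injective e := fun h =>
    p.ne_bot (hker ▸ (Setoid.injective_iff_ker_bot e).1 h)
  exact ⟨⟨e, hinj, (injective_iff_surjective_of_idempotent he).not.1 hinj⟩,
    Subtype.ext (funext he), Partitions.ext hker⟩

theorem Powerset.exists_isIdempotentElem_range_eq (A : Powerset X) {c : X} (hc : c ∈ A.carrier) :
    ∃ e : Sing X, IsIdempotentElem e ∧ e.range = A ∧ ∀ x ∉ A.carrier, e.1 x = c := by
  classical
  let e (x : X) : X := if x ∈ A.carrier then x else c
  have he_mem (x) : e x ∈ A.carrier := by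
    by_cases hx : x ∈ A.carrier
    · rwa [show e x = x from if_pos hx]
    · rwa [show e x = c from if_neg hx]
  have he (x) : e (e x) = e x := if_pos (he_mem x)
  have hrange : Set.range e = A.carrier :=
    (Set.range_subset_iff.2 he_mem).antisymm fun x hx => ⟨x, if_pos hx⟩
  have hsurj : ¬ Function.Surjective e := fun h => A.ne_univ (hrange ▸ Set.range_eq_univ.2 h)
  exact ⟨⟨e, (injective_iff_surjective_of_idempotent he).not.2 hsurj, hsurj⟩,
    Subtype.ext (funext he), Powerset.ext hrange, fun _ hx => if_neg hx⟩

theorem Powerset.subset_of_isTransversal_imp {A B : Powerset X} (hA : A.carrier.Nontrivial)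
    (h : ∀ p : Partitions X, IsTransversal p.rel A.carrier → IsTransversal p.rel B.carrier) :
    A.carrier ⊆ B.carrier := by
  intro a ha
  obtain ⟨c, hc, hca⟩ := hA.exists_ne a
  obtain ⟨e, he, rfl, hec⟩ := A.exists_isIdempotentElem_range_eq hc
  have he_self {x : X} (hx : x ∈ e.range.carrier) : e.1 x = x := by
    obtain ⟨y, rfl⟩ := hx
    exact congrFun (congrArg Subtype.val he) y
  obtain ⟨b, ⟨hb, hba⟩, -⟩ := h e.ker (Sing.isTransversal_of_isIdempotentElem he) a
  have heb : e.1 b = a := (Setoid.ker_def.1 hba).trans (he_self ha)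
  by_cases hb' : b ∈ e.range.carrier
  · rwa [← heb, he_self hb']
  · exact absurd ((hec b hb').symm.trans heb) hca

theorem Powerset.eq_of_isTransversal_iff {A B : Powerset X} (hA : A.carrier.Nontrivial)
    (h : ∀ p : Partitions X, IsTransversal p.rel A.carrier ↔ IsTransversal p.rel B.carrier) :
    A = B := by
  have hAB := subset_of_isTransversal_imp hA fun p => (h p).1
  exact Powerset.ext
    (hAB.antisymm (subset_of_isTransversal_imp (hA.mono hAB) fun p => (h p).2))

/-! ### Morphisms and cones of the category of subsets -/

namespace Powerset

/-- A morphism of `P(X)` as a function. -/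
def toFun {A B : Powerset X} (f : A ⟶ B) : A.carrier → B.carrier := f

theorem isIso_iff_bijective {A B : Powerset X} (f : A ⟶ B) :
    IsIso f ↔ Function.Bijective (toFun f) := by
  rw [Function.bijective_iff_has_inverse]
  exact ⟨fun _ => ⟨toFun (inv f), congrFun (IsIso.hom_inv_id f), congrFun (IsIso.inv_hom_id f)⟩,
    fun ⟨g, hl, hr⟩ => ⟨g, funext hl, funext hr⟩⟩

theorem isIso_iff_isTransversal {A B : Powerset X} (f : A ⟶ B) {a : X → X}
    (hf : ∀ x, (toFun f x : X) = a x) (ha : Set.range a = B.carrier) :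
    IsIso f ↔ IsTransversal (Setoid.ker a) A.carrier := by
  rw [isIso_iff_bijective]
  constructor
  · rintro ⟨hinj, hsurj⟩ x
    obtain ⟨c, hc⟩ := hsurj ⟨a x, ha.subset ⟨x, rfl⟩⟩
    refine ⟨c, ⟨c.2, by rw [Setoid.ker_def, ← hf, hc]⟩, ?_⟩
    rintro d ⟨hd, hdx⟩
    refine congrArg Subtype.val (hinj (a₁ := ⟨d, hd⟩) (Subtype.ext ?_))
    rw [hc, hf]
    exact hdx
  · refine fun h => ⟨fun c d hcd => ?_, fun y => ?_⟩
    · have hcd' : a c = a d := by rw [← hf, ← hf, hcd]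
      exact Subtype.ext (h.eq_of_rel c.2 d.2 hcd')
    · obtain ⟨x, hx⟩ := ha.superset y.2
      obtain ⟨c, ⟨hc, hcx⟩, -⟩ := h x
      exact ⟨⟨c, hc⟩, Subtype.ext ((hf _).trans (hcx.trans hx))⟩

/-- A singleton, as an object of `P(X)`. -/
def point [Nontrivial X] (x : X) : Powerset X where
  carrier := {x}
  nonempty := Set.singleton_nonempty x
  ne_univ := Set.singleton_ne_univ x

end Powerset

namespace PowersetCone

/-- The normal cone in `P(X)` whose components are the restrictions of a singular
transformation. -/
def ofSing (a : Sing X) : NormalCone (Powerset X) where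
  vertex := a.range
  app _ := fun x => (⟨a.1 x.1, x.1, rfl⟩ : Set.range a.1)
  isCone _ _ _ := rfl
  exists_isIso := by
    obtain ⟨e, he, hker⟩ := a.ker.exists_isIdempotentElem_ker_eq
    have h := Sing.isTransversal_of_isIdempotentElem he
    rw [hker] at h
    exact ⟨e.range, (Powerset.isIso_iff_isTransversal _ (fun _ => rfl) rfl).2 h⟩

variable [Nontrivial X]

/-- The transformation of `X` which restricts to all components of a cone in `P(X)`, see
`app_apply`. -/
def toMap (γ : NormalCone (Powerset X)) (x : X) : X :=
  Powerset.toFun (γ.app (Powerset.point x)) ⟨x, rfl⟩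

variable (γ δ : NormalCone (Powerset X))

theorem toMap_mem (x : X) : toMap γ x ∈ γ.vertex.carrier :=
  (Powerset.toFun (γ.app (Powerset.point x)) ⟨x, rfl⟩).2

theorem app_apply (A : Powerset X) (a : A.carrier) :
    (Powerset.toFun (γ.app A) a : X) = toMap γ a := by
  have h : SubobjOf (Powerset.point a.1) A := Set.singleton_subset_iff.2 a.2
  exact congrArg Subtype.val (congrFun (γ.isCone _ _ h) ⟨a.1, rfl⟩)

theorem range_toMap : Set.range (toMap γ) = γ.vertex.carrier := by
  refine (Set.range_subset_iff.2 (toMap_mem γ)).antisymm fun y hy => ?_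
  obtain ⟨A, hA⟩ := γ.exists_isIso
  obtain ⟨a, ha⟩ := ((Powerset.isIso_iff_bijective _).1 hA).2 ⟨y, hy⟩
  exact ⟨a, by rw [← app_apply, ha]⟩

theorem isIso_app_iff (A : Powerset X) :
    IsIso (γ.app A) ↔ IsTransversal (Setoid.ker (toMap γ)) A.carrier :=
  Powerset.isIso_iff_isTransversal _ (app_apply γ A) (range_toMap γ)

theorem toMap_injective : Function.Injective (toMap (X := X)) := fun γ δ h =>
  NormalCone.ext_of_app_incl (d := δ.vertex)
    (show γ.vertex.carrier ⊆ δ.vertex.carrier by rw [← range_toMap, h, range_toMap]) (refl _)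
    fun A => funext fun a => Subtype.ext <|
      (app_apply γ A a).trans ((congrFun h a).trans (app_apply δ A a).symm)

theorem toMap_star {A : Powerset X} (f : γ.vertex ⟶ A) (x : X) :
    toMap (γ.star f) x = Powerset.toFun f ⟨toMap γ x, toMap_mem γ x⟩ :=
  congrArg Subtype.val (congrFun (γ.star_app_incl f (Powerset.point x)) ⟨x, rfl⟩)

theorem toMap_mul : toMap (γ * δ) = toMap δ ∘ toMap γ :=
  funext fun x => (toMap_star γ _ x).trans (app_apply δ _ _)

theorem toMap_not_injective : ¬ Function.Injective (toMap γ) := by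
  obtain ⟨A, hA⟩ := γ.exists_isIso
  rw [Setoid.injective_iff_ker_bot, ((isIso_app_iff γ A).1 hA).eq_bot_iff]
  exact A.ne_univ

theorem toMap_not_surjective : ¬ Function.Surjective (toMap γ) := by
  rw [← Set.range_eq_univ, range_toMap]
  exact γ.vertex.ne_univ

/-- The normal cones in `P(X)` form a semigroup isomorphic to `Sing(X)`. -/
def mulEquivSing : NormalCone (Powerset X) ≃* Sing X where
  toFun γ := ⟨toMap γ, toMap_not_injective γ, toMap_not_surjective γ⟩
  invFun := ofSing
  left_inv _ := toMap_injective rfl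
  right_inv _ := rfl
  map_mul' γ δ := Subtype.ext (toMap_mul γ δ)

variable {γ δ}

theorem mem_H_iff {A : Powerset X} :
    δ ∈ (H γ).obj A ↔
      Set.range (toMap δ) ⊆ A.carrier ∧ Setoid.ker (toMap γ) ≤ Setoid.ker (toMap δ) := by
  constructor
  · rintro ⟨f, rfl⟩
    refine ⟨Set.range_subset_iff.2 fun x => ?_, fun x y hxy => ?_⟩
    · exact toMap_star γ f x ▸ Subtype.prop _
    · have hxy : toMap γ x = toMap γ y := hxy
      exact (toMap_star γ f x).trans (by simp only [hxy, toMap_star])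
  · rintro ⟨hrange, hker⟩
    choose s hs using fun y : γ.vertex.carrier => (range_toMap γ).superset y.2
    let f : γ.vertex ⟶ A := fun y => (⟨toMap δ (s y), hrange ⟨_, rfl⟩⟩ : A.carrier)
    exact ⟨f, toMap_injective (funext fun x => (toMap_star γ f x).trans (hker (hs _)))⟩

end PowersetCone

end

section

variable {X : Type u}

/-! ### Threads of blocks -/

theorem exists_ne_ne_ne [hX : Fact (4 ≤ ENat.card X)] (x y z : X) :
    ∃ w, w ≠ x ∧ w ≠ y ∧ w ≠ z := by
  classical
  by_contra! h
  have huniv : (Set.univ : Set X) ⊆ ({x, y, z} : Finset X) := fun w _ => by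
    have := h w
    grind
  have hle := Set.encard_le_encard huniv
  rw [Set.encard_univ, Set.encard_coe_eq_coe_finsetCard] at hle
  have h4 : 4 ≤ ({x, y, z} : Finset X).card := by exact_mod_cast hX.out.trans hle
  exact absurd (h4.trans Finset.card_le_three) (by decide)

instance [h4 : Fact (4 ≤ ENat.card X)] : Nontrivial X :=
  (ENat.one_lt_card_iff_nontrivial X).1 (lt_of_lt_of_le (by decide) h4.out)

/-- The partition whose only non-trivial block is `{a, b}`. -/
def pairPartition (a b : X) (hab : a ≠ b) : Partitions X where
  rel :=
    { r := fun x y => x = y ∨ ((x = a ∨ x = b) ∧ (y = a ∨ y = b))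
      iseqv := ⟨fun _ => Or.inl rfl, fun h => by grind, fun h k => by grind⟩ }
  ne_bot h := hab <| by
    change (⊥ : Setoid X) a b
    rw [← h]
    exact Or.inr ⟨Or.inl rfl, Or.inr rfl⟩

theorem pairPartition_le_iff {a b : X} (hab : a ≠ b) {s : Setoid X} :
    (pairPartition a b hab).rel ≤ s ↔ s a b := by
  refine ⟨fun h => h (Or.inr ⟨Or.inl rfl, Or.inr rfl⟩), fun h x y => ?_⟩
  rintro (rfl | ⟨rfl | rfl, rfl | rfl⟩)
  exacts [s.refl _, s.refl _, h, s.symm h, s.refl _]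

theorem eq_of_forall_rel [Fact (4 ≤ ENat.card X)] {x y : X} (h : ∀ p : Partitions X, p.rel x y) :
    x = y := by
  obtain ⟨a, hax⟩ := exists_ne x
  obtain ⟨b, hbx, hba, -⟩ := exists_ne_ne_ne x a a
  rcases h (pairPartition a b hba.symm) with hxy | ⟨rfl | rfl, -⟩
  exacts [hxy, absurd rfl hax, absurd rfl hbx]

/-- A thread: a choice of a block in every partition, compatible with refinement. -/
def IsThread (b : ∀ p : Partitions X, Quotient p.rel) : Prop :=
  ∀ (p q : Partitions X) (h : p.rel ≤ q.rel), blockMap h (b p) = b q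

namespace IsThread

variable {b : ∀ p : Partitions X, Quotient p.rel} (hb : IsThread b)
include hb

-- Both partitions refine the partition of `X` into the fibres of `P`.
theorem pair_iff {P : X → Prop} {c d e f : X} {hcd : c ≠ d} {hef : e ≠ f} (h₁ : P c ↔ P d)
    (h₂ : P e ↔ P f) {x y : X} (hx : b (pairPartition c d hcd) = Quotient.mk _ x)
    (hy : b (pairPartition e f hef) = Quotient.mk _ y) : P x ↔ P y := by
  have hle₁ : (pairPartition c d hcd).rel ≤ Setoid.ker P :=
    (pairPartition_le_iff hcd).2 (propext h₁)
  have hle₂ : (pairPartition e f hef).rel ≤ Setoid.ker P :=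
    (pairPartition_le_iff hef).2 (propext h₂)
  let q : Partitions X :=
    ⟨Setoid.ker P, fun h => (pairPartition c d hcd).ne_bot (le_bot_iff.1 (h ▸ hle₁))⟩
  have hq : blockMap hle₁ (Quotient.mk _ x) = blockMap hle₂ (Quotient.mk _ y) := by
    rw [← hx, ← hy]
    exact (hb _ q hle₁).trans (hb _ q hle₂).symm
  exact iff_of_eq (Quotient.exact (s := Setoid.ker P) hq)

theorem pair_eq_of_notMem {c d e f r : X} {hcd : c ≠ d} (hef : e ≠ f) (hrc : r ≠ c) (hrd : r ≠ d)
    (hr : b (pairPartition c d hcd) = Quotient.mk _ r) (hre : r ≠ e) (hrf : r ≠ f) :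
    b (pairPartition e f hef) = Quotient.mk _ r := by
  obtain ⟨y, hy⟩ := Quotient.exists_rep (b (pairPartition e f hef))
  have hyr : y = r := (hb.pair_iff (P := (· = r)) (iff_of_false hrc.symm hrd.symm)
    (iff_of_false hre.symm hrf.symm) hr hy.symm).1 rfl
  rw [← hy, hyr]

variable [Fact (4 ≤ ENat.card X)]

theorem pair_eq {c d e f r : X} {hcd : c ≠ d} (hef : e ≠ f) (hrc : r ≠ c) (hrd : r ≠ d)
    (hr : b (pairPartition c d hcd) = Quotient.mk _ r) :
    b (pairPartition e f hef) = Quotient.mk _ r := by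
  by_cases hmem : r = e ∨ r = f
  · obtain ⟨u, hue, huf, -⟩ := exists_ne_ne_ne e f f
    obtain ⟨v, hve, hvf, hvu⟩ := exists_ne_ne_ne e f u
    have huv : b (pairPartition u v hvu.symm) = Quotient.mk _ r :=
      hb.pair_eq_of_notMem hvu.symm hrc hrd hr (by grind) (by grind)
    obtain ⟨y, hy⟩ := Quotient.exists_rep (b (pairPartition e f hef))
    have hymem : y = e ∨ y = f := (hb.pair_iff (P := fun x => x = e ∨ x = f) (by grind)
      (by grind) huv hy.symm).1 hmem
    rw [← hy]
    exact Quotient.sound (Or.inr ⟨hymem, hmem⟩)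
  · rw [not_or] at hmem
    exact hb.pair_eq_of_notMem hef hrc hrd hr hmem.1 hmem.2

theorem exists_pair_eq_notMem :
    ∃ (c d r : X) (hcd : c ≠ d), r ≠ c ∧ r ≠ d ∧ b (pairPartition c d hcd) = Quotient.mk _ r := by
  obtain ⟨c, d, hcd⟩ := exists_pair_ne X
  obtain ⟨e, hec, hed, -⟩ := exists_ne_ne_ne c d d
  obtain ⟨f, hfc, hfd, hfe⟩ := exists_ne_ne_ne c d e
  obtain ⟨x, hx⟩ := Quotient.exists_rep (b (pairPartition c d hcd))
  obtain ⟨y, hy⟩ := Quotient.exists_rep (b (pairPartition e f hfe.symm))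
  have hxy : (x = c ∨ x = d) ↔ (y = c ∨ y = d) :=
    hb.pair_iff (P := fun x => x = c ∨ x = d) (by grind) (by grind) hx.symm hy.symm
  by_cases hxmem : x = c ∨ x = d
  · exact ⟨e, f, y, hfe.symm, by grind, by grind, hy.symm⟩
  · rw [not_or] at hxmem
    exact ⟨c, d, x, hcd, hxmem.1, hxmem.2, hx.symm⟩

theorem exists_point : ∃ x : X, ∀ p, b p = Quotient.mk p.rel x := by
  obtain ⟨c, d, r, hcd, hrc, hrd, hr⟩ := hb.exists_pair_eq_notMem
  refine ⟨r, fun p => ?_⟩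
  obtain ⟨e, f, hef, hp⟩ := p.exists_ne_rel
  rw [← hb _ p ((pairPartition_le_iff hef).2 hp), hb.pair_eq hef hrc hrd hr]
  rfl

end IsThread

/-! ### Morphisms and cones of the category of partitions -/

namespace Partitions

/-- A morphism of `Π(X)` as a function on blocks, in the opposite direction. -/
def toFun {p q : Partitions X} (f : p ⟶ q) : Quotient q.rel → Quotient p.rel := f

theorem isIso_iff_bijective {p q : Partitions X} (f : p ⟶ q) :
    IsIso f ↔ Function.Bijective (toFun f) := by
  rw [Function.bijective_iff_has_inverse]
  exact ⟨fun _ => ⟨toFun (inv f), congrFun (IsIso.inv_hom_id f), congrFun (IsIso.hom_inv_id f)⟩,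
    fun ⟨g, hl, hr⟩ => ⟨g, funext hr, funext hl⟩⟩

theorem isIso_iff_isTransversal {p q : Partitions X} (f : p ⟶ q) {a : X → X}
    (hf : ∀ x, toFun f (Quotient.mk _ x) = Quotient.mk _ (a x)) (ha : Setoid.ker a = q.rel) :
    IsIso f ↔ IsTransversal p.rel (Set.range a) := by
  rw [isIso_iff_bijective]
  constructor
  · rintro ⟨hinj, hsurj⟩ x
    obtain ⟨⟨y⟩, hy⟩ := hsurj (Quotient.mk _ x)
    refine ⟨a y, ⟨⟨y, rfl⟩, Quotient.exact ((hf y).symm.trans hy)⟩, ?_⟩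
    rintro _ ⟨⟨z, rfl⟩, hz⟩
    have hzy : toFun f (Quotient.mk _ z) = toFun f (Quotient.mk _ y) :=
      (hf z).trans ((Quotient.sound hz).trans hy.symm)
    exact ha.ge (Quotient.exact (hinj hzy))
  · refine fun h => ⟨?_, ?_⟩
    · rintro ⟨x⟩ ⟨y⟩ hxy
      have hrel : p.rel (a x) (a y) := Quotient.exact ((hf x).symm.trans (hxy.trans (hf y)))
      exact Quotient.sound (ha.le (h.eq_of_rel ⟨x, rfl⟩ ⟨y, rfl⟩ hrel))
    · rintro ⟨x⟩
      obtain ⟨_, ⟨⟨y, rfl⟩, hy⟩, -⟩ := h x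
      exact ⟨Quotient.mk _ y, (hf y).trans (Quotient.sound hy)⟩

end Partitions

namespace PartitionCone

/-- The normal cone in `Π(X)` whose components are the maps of blocks induced by a singular
transformation. -/
def ofSing (a : Sing X) : NormalCone (Partitions X) where
  vertex := a.ker
  app p := Quotient.lift (fun x => Quotient.mk p.rel (a.1 x)) fun _ _ h => congrArg _ h
  isCone p q h := by
    funext y
    obtain ⟨x, rfl⟩ := Quotient.exists_rep y
    rfl
  exists_isIso := by
    obtain ⟨_, hc⟩ := a.range.nonempty
    obtain ⟨e, he, hrange, -⟩ := a.range.exists_isIdempotentElem_range_eq hc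
    have h := Sing.isTransversal_of_isIdempotentElem he
    rw [hrange] at h
    exact ⟨e.ker, (Partitions.isIso_iff_isTransversal _ (fun _ => rfl) rfl).2 h⟩

theorem isThread (σ : NormalCone (Partitions X)) (y : Quotient σ.vertex.rel) :
    IsThread fun p => Partitions.toFun (σ.app p) y :=
  fun p q h => congrFun (σ.isCone q p h) y

variable [Fact (4 ≤ ENat.card X)]

/-- The transformation of `X` which induces all components of a cone in `Π(X)`, see
`app_apply`. -/
noncomputable def toMap (σ : NormalCone (Partitions X)) (x : X) : X :=
  (isThread σ (Quotient.mk _ x)).exists_point.choose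

variable (σ τ : NormalCone (Partitions X))

theorem app_apply (p : Partitions X) (x : X) :
    Partitions.toFun (σ.app p) (Quotient.mk _ x) = Quotient.mk _ (toMap σ x) :=
  (isThread σ (Quotient.mk _ x)).exists_point.choose_spec p

theorem ker_toMap : Setoid.ker (toMap σ) = σ.vertex.rel := by
  refine le_antisymm (fun x y h => ?_) fun x y h => eq_of_forall_rel fun p => ?_
  · obtain ⟨p, hp⟩ := σ.exists_isIso
    refine Quotient.exact (((Partitions.isIso_iff_bijective (σ.app p)).1 hp).1 ?_)
    rw [app_apply, app_apply]
    exact congrArg _ h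
  · refine Quotient.exact (s := p.rel) ?_
    rw [← app_apply, ← app_apply, Quotient.sound (s := σ.vertex.rel) h]

theorem isIso_app_iff (p : Partitions X) :
    IsIso (σ.app p) ↔ IsTransversal p.rel (Set.range (toMap σ)) :=
  Partitions.isIso_iff_isTransversal _ (app_apply σ p) (ker_toMap σ)

theorem toMap_injective : Function.Injective (toMap (X := X)) := fun σ τ h =>
  NormalCone.ext_of_app_incl (d := τ.vertex)
    (show τ.vertex.rel ≤ σ.vertex.rel by rw [← ker_toMap, ← h, ker_toMap]) (refl _)
    fun p => funext <| Quotient.ind fun x =>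
      (app_apply σ p x).trans ((congrArg _ (congrFun h x)).trans (app_apply τ p x).symm)

theorem toMap_star {p : Partitions X} (f : σ.vertex ⟶ p) {x y : X}
    (h : Partitions.toFun f (Quotient.mk _ x) = Quotient.mk _ y) :
    toMap (σ.star f) x = toMap σ y := by
  refine eq_of_forall_rel fun q => Quotient.exact (s := q.rel) ?_
  rw [← app_apply, ← app_apply, ← h]
  exact congrFun (σ.star_app_incl f q) (Quotient.mk _ x)

theorem toMap_mul : toMap (σ * τ) = toMap σ ∘ toMap τ :=
  funext fun x => toMap_star σ _ (app_apply τ _ x)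

theorem toMap_not_injective : ¬ Function.Injective (toMap σ) := by
  rw [Setoid.injective_iff_ker_bot, ker_toMap]
  exact σ.vertex.ne_bot

theorem toMap_not_surjective : ¬ Function.Surjective (toMap σ) := by
  obtain ⟨p, hp⟩ := σ.exists_isIso
  rw [← Set.range_eq_univ, ← ((isIso_app_iff σ p).1 hp).eq_bot_iff]
  exact p.ne_bot

theorem toMap_ofSing (a : Sing X) : toMap (ofSing a) = a.1 :=
  funext fun x => eq_of_forall_rel fun p =>
    Quotient.exact (s := p.rel) (app_apply (ofSing a) p x).symm

/-- The normal cones in `Π(X)` form a semigroup anti-isomorphic to `Sing(X)`. -/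
noncomputable def mulEquivSing : (NormalCone (Partitions X))ᵐᵒᵖ ≃* Sing X where
  toFun σ := ⟨toMap σ.unop, toMap_not_injective _, toMap_not_surjective _⟩
  invFun a := MulOpposite.op (ofSing a)
  left_inv _ := MulOpposite.unop_injective (toMap_injective (toMap_ofSing _))
  right_inv a := Subtype.ext (toMap_ofSing a)
  map_mul' σ τ := Subtype.ext (toMap_mul τ.unop σ.unop)

variable {σ τ}

theorem mem_H_iff {p : Partitions X} :
    τ ∈ (H σ).obj p ↔
      Set.range (toMap τ) ⊆ Set.range (toMap σ) ∧ p.rel ≤ Setoid.ker (toMap τ) := by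
  constructor
  · rintro ⟨f, rfl⟩
    choose s hs using fun x => Quotient.exists_rep (Partitions.toFun f (Quotient.mk p.rel x))
    refine ⟨Set.range_subset_iff.2 fun x => ⟨s x, (toMap_star σ f (hs x).symm).symm⟩,
      fun x y hxy => ?_⟩
    have hy : Partitions.toFun f (Quotient.mk _ y) = Quotient.mk _ (s x) := by
      rw [hs, Quotient.sound (s := p.rel) hxy]
    exact (toMap_star σ f (hs x).symm).trans (toMap_star σ f hy).symm
  · rintro ⟨hrange, hker⟩
    choose s hs using fun x => hrange ⟨x, rfl⟩
    have hker_s (x y) (hxy : p.rel x y) : σ.vertex.rel (s x) (s y) :=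
      (ker_toMap σ).le ((hs x).trans ((hker hxy).trans (hs y).symm))
    let f : σ.vertex ⟶ p :=
      Quotient.lift (fun x => Quotient.mk σ.vertex.rel (s x)) fun x y hxy =>
        Quotient.sound (hker_s x y hxy)
    exact ⟨f, toMap_injective (funext fun x => (toMap_star σ f rfl).trans (hs x))⟩

end PartitionCone

end

section

variable {X : Type u}

/-! ### The normal duals of the two categories -/

namespace PowersetDual

open PowersetCone NormalDual

variable [Nontrivial X]

/-- The partition corresponding to the object `H(ε; -)` of `N*P(X)`: the kernel of `ε`. -/
noncomputable def part (F : NormalDual (Powerset X)) : Partitions X :=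
  (mulEquivSing F.gen).ker

variable {F G : NormalDual (Powerset X)} {A B : Powerset X} {γ : NormalCone (Powerset X)}

theorem mem_iff :
    γ ∈ F.1.obj A ↔
      Set.range (toMap γ) ⊆ A.carrier ∧ (part F).rel ≤ Setoid.ker (toMap γ) := by
  rw [F.eq_H]
  exact mem_H_iff

theorem mem_carrier (γ : F.1.obj A) (x : X) : toMap γ.1 x ∈ A.carrier :=
  (mem_iff.1 γ.2).1 ⟨x, rfl⟩

theorem toMap_eq_of_rel (γ : F.1.obj A) {x y : X} (h : (part F).rel x y) :
    toMap γ.1 x = toMap γ.1 y :=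
  (mem_iff.1 γ.2).2 h

theorem toMap_map (g : A ⟶ B) (γ : F.1.obj A) (x : X) :
    toMap (F.1.map g γ).1 x = Powerset.toFun g ⟨toMap γ.1 x, mem_carrier γ x⟩ := by
  rw [map_eq_star, toMap_star]
  rfl

theorem part_rel_eq (h : F.1 = H γ) : (part F).rel = Setoid.ker (toMap γ) :=
  le_antisymm (mem_iff.1 (h ▸ mem_H_self γ : γ ∈ F.1.obj γ.vertex)).2
    (mem_H_iff.1 (h ▸ F.gen_mem : F.gen ∈ (H γ).obj F.gen.vertex)).2

theorem subobjOf_iff : SubobjOf F G ↔ (part G).rel ≤ (part F).rel := by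
  rw [subobjOf_iff_obj_subset]
  exact ⟨fun h => (mem_iff.1 (h _ F.gen_mem)).2,
    fun h A γ hγ => mem_iff.2 ⟨(mem_iff.1 hγ).1, h.trans (mem_iff.1 hγ).2⟩⟩

theorem exists_part_eq (p : Partitions X) : ∃ F : NormalDual (Powerset X), part F = p := by
  obtain ⟨e, he, rfl⟩ := p.exists_isIdempotentElem_ker_eq
  let F : NormalDual (Powerset X) := ⟨_, ofSing e, he.map mulEquivSing.symm, rfl⟩
  exact ⟨F, Partitions.ext (part_rel_eq (F := F) rfl)⟩

theorem mem_MSet_iff : A ∈ MSet F ↔ IsTransversal (part F).rel A.carrier := by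
  refine ⟨?_, fun h => ⟨F.gen, F.eq_H, (isIso_app_iff _ A).2 h⟩⟩
  rintro ⟨γ, hγ, hA⟩
  rw [part_rel_eq hγ]
  exact (isIso_app_iff γ A).1 hA

end PowersetDual

namespace PartitionDual

open PartitionCone NormalDual

variable [Fact (4 ≤ ENat.card X)]

/-- The subset corresponding to the object `H(ε; -)` of `N*Π(X)`: the range of `ε`. -/
noncomputable def subset (F : NormalDual (Partitions X)) : Powerset X :=
  (mulEquivSing (MulOpposite.op F.gen)).range

variable {F G : NormalDual (Partitions X)} {p q : Partitions X} {σ : NormalCone (Partitions X)}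

theorem mem_iff :
    σ ∈ F.1.obj p ↔
      Set.range (toMap σ) ⊆ (subset F).carrier ∧ p.rel ≤ Setoid.ker (toMap σ) := by
  rw [F.eq_H]
  exact mem_H_iff

theorem mem_subset (σ : F.1.obj p) (x : X) : toMap σ.1 x ∈ (subset F).carrier :=
  (mem_iff.1 σ.2).1 ⟨x, rfl⟩

theorem toMap_eq_of_rel (σ : F.1.obj p) {x y : X} (h : p.rel x y) : toMap σ.1 x = toMap σ.1 y :=
  (mem_iff.1 σ.2).2 h

theorem toMap_map (g : p ⟶ q) (σ : F.1.obj p) {x y : X}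
    (h : Partitions.toFun g (Quotient.mk _ x) = Quotient.mk _ y) :
    toMap (F.1.map g σ).1 x = toMap σ.1 y := by
  rw [map_eq_star]
  exact toMap_star _ _ (congrArg (Partitions.toFun (incl (subobjOf_vertex σ))) h)

theorem hom_ext_toMap {s t : F ⟶ G}
    (h : ∀ p σ x, toMap (appl s p σ).1 x = toMap (appl t p σ).1 x) : s = t :=
  hom_ext fun p σ => Subtype.ext (toMap_injective (funext (h p σ)))

theorem subset_carrier_eq (h : F.1 = H σ) : (subset F).carrier = Set.range (toMap σ) :=
  Set.Subset.antisymm (mem_H_iff.1 (h ▸ F.gen_mem : F.gen ∈ (H σ).obj F.gen.vertex)).1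
    (mem_iff.1 (h ▸ mem_H_self σ : σ ∈ F.1.obj σ.vertex)).1

theorem subobjOf_iff : SubobjOf F G ↔ (subset F).carrier ⊆ (subset G).carrier := by
  rw [subobjOf_iff_obj_subset]
  exact ⟨fun h => (mem_iff.1 (h _ F.gen_mem)).1,
    fun h p σ hσ => mem_iff.2 ⟨(mem_iff.1 hσ).1.trans h, (mem_iff.1 hσ).2⟩⟩

theorem subset_injective : Function.Injective (subset (X := X)) := fun _ _ h =>
  antisymm (subobjOf_iff.2 (congrArg Powerset.carrier h).subset)
    (subobjOf_iff.2 (congrArg Powerset.carrier h).superset)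

theorem exists_subset_eq (A : Powerset X) : ∃ F : NormalDual (Partitions X), subset F = A := by
  obtain ⟨c, hc⟩ := A.nonempty
  obtain ⟨e, he, rfl, -⟩ := A.exists_isIdempotentElem_range_eq hc
  have he' : IsIdempotentElem (ofSing e) :=
    MulOpposite.op_injective (he.map mulEquivSing.symm)
  let F : NormalDual (Partitions X) := ⟨_, ofSing e, he', rfl⟩
  exact ⟨F, Powerset.ext <|
    (subset_carrier_eq (F := F) rfl).trans (congrArg Set.range (toMap_ofSing e))⟩

theorem mem_MSet_iff : p ∈ MSet F ↔ IsTransversal p.rel (subset F).carrier := by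
  refine ⟨?_, fun h => ⟨F.gen, F.eq_H, (isIso_app_iff _ p).2 h⟩⟩
  rintro ⟨σ, hσ, hp⟩
  rw [subset_carrier_eq hσ]
  exact (isIso_app_iff σ p).1 hp

end PartitionDual

end

section

variable {X : Type u} [Nontrivial X]

/-! ### The permutation of a cross-connection -/

/-- The cone in `P(X)` of the constant transformation with value `z`. -/
def PowersetCone.const (z : X) : NormalCone (Powerset X) :=
  ofSing
    ⟨fun _ => z, Function.not_injective_const, fun h => by
      obtain ⟨y, hy⟩ := exists_ne z
      obtain ⟨_, rfl⟩ := h y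
      exact hy rfl⟩

namespace Partitions

/-- The partition with one block. -/
def top : Partitions X where
  rel := ⊤
  ne_bot h := by
    obtain ⟨x, y, hxy⟩ := exists_pair_ne X
    exact hxy (h.le (trivial : (⊤ : Setoid X) x y))

/-- The morphism from `p` to the partition with one block which is given by the block of `x`. -/
def toTop (p : Partitions X) (x : X) : p ⟶ top :=
  fun _ => Quotient.mk p.rel x

theorem toTop_eq_iff {p : Partitions X} {x y : X} : p.toTop x = p.toTop y ↔ p.rel x y :=
  ⟨fun h => Quotient.exact (congrFun h (Quotient.mk _ x)),
    fun h => funext fun _ => Quotient.sound h⟩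

theorem exists_eq_toTop {p : Partitions X} (f : p ⟶ top) : ∃ x, f = p.toTop x := by
  obtain ⟨z⟩ := (inferInstance : Nonempty X)
  obtain ⟨x, hx⟩ := Quotient.exists_rep (toFun f (Quotient.mk _ z))
  refine ⟨x, funext <| Quotient.ind fun y => Eq.trans ?_ hx.symm⟩
  exact congrArg (toFun f) (Quotient.sound (s := ⊤) trivial)

theorem incl_toTop {p q : Partitions X} (h : SubobjOf q p) (x : X) :
    incl h ≫ p.toTop x = q.toTop x := rfl

end Partitions

namespace PowersetDual

open PowersetCone NormalDual

variable (F G : NormalDual (Powerset X))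

theorem const_mem {A : Powerset X} {a : X} (ha : a ∈ A.carrier) : const a ∈ F.1.obj A :=
  mem_iff.2 ⟨Set.range_subset_iff.2 fun _ => ha, fun _ _ _ => rfl⟩

theorem map_const {A B : Powerset X} (g : A ⟶ B) (a : A.carrier) :
    F.1.map g ⟨const a, const_mem F a.2⟩ =
      ⟨const (Powerset.toFun g a), const_mem F (Powerset.toFun g a).2⟩ :=
  Subtype.ext (toMap_injective (funext fun z => toMap_map g _ z))

/-- The morphism of `N*P(X)` which sends a cone to the constant cone with the value at `y`. -/
def evalHom (y : X) : F ⟶ G :=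
  homMk (fun _ γ => ⟨const (toMap γ.1 y), const_mem G (mem_carrier γ y)⟩) fun g γ => by
    rw [map_const G g ⟨toMap γ.1 y, mem_carrier γ y⟩]
    exact Subtype.ext (congrArg const (toMap_map g γ y))

variable {F G}

theorem evalHom_eq_iff {y z : X} : evalHom F G y = evalHom F G z ↔ (part F).rel y z := by
  constructor
  · intro h
    exact congrArg
      (fun t => toMap (appl t F.gen.vertex ⟨F.gen, F.gen_mem⟩ : NormalCone (Powerset X)) y) h
  · exact fun h => hom_ext fun A γ => Subtype.ext (congrArg const (toMap_eq_of_rel γ h))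

theorem exists_eq_evalHom (hG : (part G).rel = ⊤) (t : F ⟶ G) : ∃ y, t = evalHom F G y := by
  let γ := appl t F.gen.vertex ⟨F.gen, F.gen_mem⟩
  obtain ⟨z⟩ := (inferInstance : Nonempty X)
  obtain ⟨y, hy⟩ := (range_toMap F.gen).superset (mem_carrier γ z)
  have hconst (w : X) : toMap γ.1 w = toMap γ.1 z := toMap_eq_of_rel γ (by rw [hG]; trivial)
  exact ⟨y, hom_ext_gen <| Subtype.ext <| toMap_injective <| funext fun w =>
    (hconst w).trans hy.symm⟩

end PowersetDual

section

open PowersetDual PowersetCone NormalDual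

variable {Γ : Partitions X ⥤ NormalDual (Powerset X)} {f : X → X}

/-- The functor `Γ` is induced by the transformation `f` of `X`: it sends the morphism from `p` to
the partition with one block which is given by the block of `f y` to the evaluation at `y`. -/
def IsInducedBy (Γ : Partitions X ⥤ NormalDual (Powerset X)) (f : X → X) : Prop :=
  ∀ p y, Γ.map (p.toTop (f y)) = evalHom (Γ.obj p) (Γ.obj Partitions.top) y

theorem IsInducedBy.part_rel_iff (hf : IsInducedBy Γ f) [Γ.Faithful] {p : Partitions X}
    {y z : X} : (part (Γ.obj p)).rel y z ↔ p.rel (f y) (f z) := by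
  rw [← evalHom_eq_iff (G := Γ.obj Partitions.top), ← hf, ← hf, ← Partitions.toTop_eq_iff]
  exact Γ.map_injective.eq_iff

theorem IsInducedBy.toMap_appl_map (hf : IsInducedBy Γ f) {p q : Partitions X} (g : p ⟶ q)
    {y z : X} (h : Partitions.toFun g (Quotient.mk _ (f z)) = Quotient.mk _ (f y))
    {A : Powerset X} (γ : (Γ.obj p).1.obj A) :
    toMap (appl (Γ.map g) A γ).1 z = toMap γ.1 y := by
  have hg : g ≫ q.toTop (f z) = p.toTop (f y) := funext fun _ => h
  have hmap : Γ.map g ≫ evalHom (Γ.obj q) (Γ.obj Partitions.top) z = evalHom (Γ.obj p) _ y := by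
    rw [← hf, ← hf, ← hg, Γ.map_comp]
  exact congrArg (fun t => toMap (appl t A γ : NormalCone (Powerset X)) z) hmap

theorem IsLocalIso.part_top (hΓ : IsLocalIso Γ) : (part (Γ.obj Partitions.top)).rel = ⊤ := by
  obtain ⟨F, hF⟩ := exists_part_eq (Partitions.top (X := X))
  have hle : SubobjOf F (Γ.obj Partitions.top) := by
    rw [subobjOf_iff, hF]
    exact le_top
  obtain ⟨p, hp, hpF⟩ := (hΓ.ideal Partitions.top).surjOn hle
  obtain rfl : p = Partitions.top := Partitions.ext (top_le_iff.1 hp)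
  rw [hpF, hF]
  rfl

theorem IsLocalIso.exists_map_toTop_eq_evalHom (hΓ : IsLocalIso Γ) (p : Partitions X) (y : X) :
    ∃ x, Γ.map (p.toTop x) = evalHom (Γ.obj p) (Γ.obj Partitions.top) y := by
  have := hΓ.full
  obtain ⟨t, ht⟩ := Γ.map_surjective (evalHom (Γ.obj p) (Γ.obj Partitions.top) y)
  obtain ⟨x, rfl⟩ := Partitions.exists_eq_toTop t
  exact ⟨x, ht⟩

end

end

section

open PowersetDual PowersetCone NormalDual

variable {X : Type u} [Fact (4 ≤ ENat.card X)] {Γ : Partitions X ⥤ NormalDual (Powerset X)}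
  {f : X → X}

/-- The subset `{x, y}`, as an object of `P(X)`. -/
def Powerset.pair (x y : X) : Powerset X where
  carrier := {x, y}
  nonempty := Set.insert_nonempty x {y}
  ne_univ h := by
    obtain ⟨z, hzx, hzy, -⟩ := exists_ne_ne_ne x y y
    have hz : z ∈ ({x, y} : Set X) := h ▸ Set.mem_univ z
    grind

theorem IsLocalIso.exists_isInducedBy (hΓ : IsLocalIso Γ) : ∃ f, IsInducedBy Γ f := by
  have := hΓ.faithful
  suffices h : ∀ y, ∃ x, ∀ p : Partitions X, Γ.map (p.toTop x) = evalHom _ _ y by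
    choose f hf using h
    exact ⟨f, fun p y => hf y p⟩
  intro y
  choose b hb using fun p => hΓ.exists_map_toTop_eq_evalHom p y
  have hthread : IsThread fun p : Partitions X => Quotient.mk p.rel (b p) := fun p q h => by
    have hqp : SubobjOf q p := h
    obtain ⟨hqp', hincl⟩ := hΓ.map_incl hqp
    have hmap : Γ.map (q.toTop (b p)) = Γ.map (q.toTop (b q)) := by
      rw [hb q, ← Partitions.incl_toTop hqp, Γ.map_comp, hb p, hincl]
      rfl
    exact Quotient.sound (Partitions.toTop_eq_iff.1 (Γ.map_injective hmap))
  obtain ⟨x, hx⟩ := hthread.exists_point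
  exact ⟨x, fun p => by rw [← hb p, Partitions.toTop_eq_iff.2 (Quotient.exact (hx p))]⟩

theorem IsInducedBy.injective (hf : IsInducedBy Γ f) (hΓ : IsCrossConnection Γ) :
    Function.Injective f := by
  have := hΓ.isLocalIso.faithful
  intro y z hyz
  obtain ⟨p, hp⟩ := hΓ.total (Powerset.pair y z)
  refine (mem_MSet_iff.1 hp).eq_of_rel (Or.inl rfl) (Or.inr rfl) (hf.part_rel_iff.2 ?_)
  rw [hyz]

theorem IsInducedBy.surjective (hf : IsInducedBy Γ f) (hΓ : IsLocalIso Γ) :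
    Function.Surjective f := by
  have := hΓ.faithful
  intro x
  obtain ⟨a, hax⟩ := exists_ne x
  obtain ⟨b, hbx, hba, -⟩ := exists_ne_ne_ne x a a
  let p := pairPartition a b hba.symm
  obtain ⟨y, hy⟩ := exists_eq_evalHom hΓ.part_top (Γ.map (p.toTop x))
  rw [← hf] at hy
  rcases Partitions.toTop_eq_iff.1 (Γ.map_injective hy) with hxy | ⟨rfl | rfl, -⟩
  exacts [⟨y, hxy.symm⟩, absurd rfl hax, absurd rfl hbx]

theorem IsCrossConnection.exists_perm (hΓ : IsCrossConnection Γ) :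
    ∃ f : Equiv.Perm X, IsInducedBy Γ f := by
  obtain ⟨f, hf⟩ := hΓ.isLocalIso.exists_isInducedBy
  exact ⟨.ofBijective f ⟨hf.injective hΓ, hf.surjective hΓ.isLocalIso⟩, hf⟩

end

/-! ### The duals of a cross-connection -/

theorem exists_subsemigroup_eq_graph {M N : Type*} [Mul M] [Mul N] (θ : M →ₙ* N)
    {L : Set (M × N)} (hL : ∀ x, x ∈ L ↔ x.2 = θ x.1) :
    ∃ S : Subsemigroup (M × N), (S : Set (M × N)) = L ∧ Nonempty (S ≃* M) := by
  let φ : M →ₙ* M × N := (MulHom.id M).prod θ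
  have hφ : Function.Injective φ := fun x y h => congrArg Prod.fst h
  refine ⟨φ.srange, Set.ext fun x => ?_,
    ⟨(MulEquiv.ofBijective φ.srangeRestrict ⟨?_, φ.srangeRestrict_surjective⟩).symm⟩⟩
  · rw [hL]
    constructor
    · rintro ⟨x, rfl⟩
      rfl
    · exact fun h => ⟨x.1, Prod.ext rfl h.symm⟩
  · exact fun x y h => hφ (congrArg Subtype.val h)

theorem exists_subsemigroup_mulEquiv_sing {X : Type u} [Nontrivial X] {N : Type*} [Mul N]
    (θ : NormalCone (Powerset X) →ₙ* N)
    {L : Set (NormalCone (Powerset X) × N)} (hL : ∀ x, x ∈ L ↔ x.2 = θ x.1) :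
    ∃ S : Subsemigroup (NormalCone (Powerset X) × N),
      (S : Set (NormalCone (Powerset X) × N)) = L ∧ Nonempty (S ≃* Sing X) := by
  obtain ⟨S, hS, ⟨e⟩⟩ := exists_subsemigroup_eq_graph θ hL
  exact ⟨S, hS, ⟨e.trans PowersetCone.mulEquivSing⟩⟩

section

variable {X : Type u}

theorem isTransversal_image_iff {Y : Type*} (f : X ≃ Y) {s : Setoid Y} {A : Set X} :
    IsTransversal s (f '' A) ↔ IsTransversal (s.comap f) A := by
  simp only [IsTransversal, f.surjective.forall, Setoid.comap_rel]
  refine forall_congr' fun x => ?_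
  rw [← f.existsUnique_congr_right]
  simp only [f.injective.mem_set_image]

/-- The image of a subset under a permutation, as an object of `P(X)`. -/
def Powerset.image (f : Equiv.Perm X) (A : Powerset X) : Powerset X where
  carrier := f '' A.carrier
  nonempty := A.nonempty.image f
  ne_univ := fun h => A.ne_univ (by rw [← f.preimage_image A.carrier, h, Set.preimage_univ])

/-- Conjugation by a permutation, as an automorphism of `Sing(X)`. -/
def Sing.conj (f : Equiv.Perm X) : Sing X ≃* Sing X where
  toFun a := ⟨f ∘ a.1 ∘ f.symm, by simpa using a.2.1, by simpa using a.2.2⟩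
  invFun a := ⟨f.symm ∘ a.1 ∘ f, by simpa using a.2.1, by simpa using a.2.2⟩
  left_inv a := Subtype.ext (funext fun x => by simp)
  right_inv a := Subtype.ext (funext fun x => by simp)
  map_mul' a b := Subtype.ext (funext fun x => congrArg (fun y => f (b.1 y)) (by simp))

variable [Fact (4 ≤ ENat.card X)]

/-- The anti-isomorphism from the normal cones in `P(X)` to the normal cones in `Π(X)` which
conjugates the corresponding transformations by `f`. -/
noncomputable def coneMulEquiv (f : Equiv.Perm X) :
    NormalCone (Powerset X) ≃* (NormalCone (Partitions X))ᵐᵒᵖ :=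
  PowersetCone.mulEquivSing.trans ((Sing.conj f).trans PartitionCone.mulEquivSing.symm)

theorem toMap_coneMulEquiv (f : Equiv.Perm X) (γ : NormalCone (Powerset X)) (x : X) :
    PartitionCone.toMap (coneMulEquiv f γ).unop (f x) = f (PowersetCone.toMap γ x) := by
  refine (congrFun (PartitionCone.toMap_ofSing _) (f x)).trans ?_
  exact congrArg (fun y => f (PowersetCone.toMap γ y)) (f.symm_apply_apply x)

theorem eq_coneMulEquiv_iff {f : Equiv.Perm X} {γ : NormalCone (Powerset X)}
    {δ : (NormalCone (Partitions X))ᵐᵒᵖ} :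
    δ = coneMulEquiv f γ ↔
      ∀ x, PartitionCone.toMap δ.unop (f x) = f (PowersetCone.toMap γ x) := by
  refine ⟨fun h x => h ▸ toMap_coneMulEquiv f γ x, fun h => ?_⟩
  refine MulOpposite.unop_injective (PartitionCone.toMap_injective (funext ?_))
  exact f.surjective.forall.2 fun x => (h x).trans (toMap_coneMulEquiv f γ x).symm

variable {Γ : Partitions X ⥤ NormalDual (Powerset X)} {f : Equiv.Perm X}
  {Δ : Powerset X ⥤ NormalDual (Partitions X)} {A : Powerset X} {p : Partitions X}

theorem IsInducedBy.mem_MSet_iff (hf : IsInducedBy Γ f) [Γ.Faithful] :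
    A ∈ MSet (Γ.obj p) ↔ IsTransversal p.rel (A.image f).carrier := by
  have hpart : (PowersetDual.part (Γ.obj p)).rel = p.rel.comap f :=
    Setoid.ext fun _ _ => hf.part_rel_iff
  rw [PowersetDual.mem_MSet_iff, hpart]
  exact (isTransversal_image_iff f).symm

theorem IsInducedBy.mem_obj_iff (hf : IsInducedBy Γ f) [Γ.Faithful]
    {γ : NormalCone (Powerset X)} {F : NormalDual (Partitions X)}
    (hF : PartitionDual.subset F = A.image f) :
    γ ∈ (Γ.obj p).1.obj A ↔ (coneMulEquiv f γ).unop ∈ F.1.obj p := by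
  rw [PowersetDual.mem_iff, PartitionDual.mem_iff, hF, Set.range_subset_iff, Set.range_subset_iff,
    f.surjective.forall (p := fun x => _ ∈ (A.image f).carrier)]
  refine and_congr (forall_congr' fun x => ?_) ?_
  · rw [toMap_coneMulEquiv]
    exact f.injective.mem_set_image.symm
  · simp only [Setoid.le_def, Setoid.ker_def]
    rw [f.surjective.forall₂ (p := fun x y => p.rel x y → _)]
    simp only [hf.part_rel_iff, toMap_coneMulEquiv, f.injective.eq_iff]

theorem IsInducedBy.exists_mem (hf : IsInducedBy Γ f) [Γ.Faithful] (γ : NormalCone (Powerset X)) :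
    ∃ A p, γ ∈ (Γ.obj p).1.obj A := by
  refine ⟨γ.vertex, (coneMulEquiv f γ).unop.vertex,
    PowersetDual.mem_iff.2 ⟨(PowersetCone.range_toMap γ).subset, fun x y hxy => f.injective ?_⟩⟩
  rw [← toMap_coneMulEquiv, ← toMap_coneMulEquiv]
  exact (PartitionCone.ker_toMap _).ge (hf.part_rel_iff.1 hxy)

open PartitionDual in
theorem IsDualOf.subset_obj (hΔ : IsDualOf Δ Γ) (hf : IsInducedBy Γ f) [Γ.Faithful]
    (A : Powerset X) : subset (Δ.obj A) = A.image f := by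
  have hnontrivial {B : Powerset X} (hB : B.carrier.Nontrivial) :
      subset (Δ.obj B) = B.image f :=
    (Powerset.eq_of_isTransversal_iff (hB.image f.injective) fun p => by
      rw [← PartitionDual.mem_MSet_iff, ← hΔ.mem_MSet_iff, hf.mem_MSet_iff]).symm
  by_cases hA : A.carrier.Nontrivial
  · exact hnontrivial hA
  obtain ⟨x, hx⟩ := A.nonempty
  have hAx : A.carrier = {x} := (Set.not_nontrivial_iff.1 hA).eq_singleton_of_mem hx
  have hsubset {y : X} (hy : y ≠ x) : (subset (Δ.obj A)).carrier ⊆ {f x, f y} := by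
    have hAy : SubobjOf A (Powerset.pair x y) := hAx.trans_subset (by simp [Powerset.pair])
    obtain ⟨hΔA, -⟩ := hΔ.isCrossConnection.isLocalIso.map_incl hAy
    rw [subobjOf_iff, hnontrivial (B := Powerset.pair x y) (Set.nontrivial_pair hy.symm)] at hΔA
    exact hΔA.trans (Set.image_pair f x y).subset
  obtain ⟨y, hy⟩ := exists_ne x
  obtain ⟨z, hzx, hzy, -⟩ := exists_ne_ne_ne x y y
  have hsubset_singleton : (subset (Δ.obj A)).carrier ⊆ {f x} := fun b hb => by
    have := f.injective.ne hzy
    grind [hsubset hy hb, hsubset hzx hb]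
  refine Powerset.ext
    (((subset (Δ.obj A)).nonempty.subset_singleton_iff.1 hsubset_singleton).trans ?_)
  exact (hAx ▸ Set.image_singleton.symm : {f x} = f '' A.carrier)

variable [Γ.Faithful] (hf : IsInducedBy Γ f) (hΔ : IsDualOf Δ Γ) (χ : bifunctor Γ ≅ dualBifunctor Δ)
include hf hΔ

theorem toMap_component_const {a : X} (ha : a ∈ A.carrier) (x : X) :
    PartitionCone.toMap
      (component χ A p ⟨PowersetCone.const a, PowersetDual.const_mem (Γ.obj p) ha⟩).1 x = f a := by
  have hsub : SubobjOf (Powerset.point a) A := Set.singleton_subset_iff.2 ha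
  obtain ⟨hsub', hincl⟩ := hΔ.isCrossConnection.isLocalIso.map_incl hsub
  have hmem (σ : (Δ.obj (Powerset.point a)).1.obj p) : PartitionCone.toMap σ.1 x = f a := by
    have h := PartitionDual.mem_subset σ x
    rw [hΔ.subset_obj hf] at h
    obtain ⟨_, rfl, h⟩ := h
    exact h.symm
  have hconst := component_map χ (incl hsub) p
    ⟨PowersetCone.const a, PowersetDual.const_mem (Γ.obj p) rfl⟩
  rw [hincl, PowersetDual.map_const (Γ.obj p) (incl hsub) ⟨a, rfl⟩] at hconst
  exact (congrArg (fun σ => PartitionCone.toMap σ.1 x) hconst).trans (hmem _)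

-- Naturality along the evaluation at `x` reduces this to constant cones.
theorem toMap_component (γ : (Γ.obj p).1.obj A) (x : X) :
    PartitionCone.toMap (component χ A p γ).1 (f x) = f (PowersetCone.toMap γ.1 x) := by
  have hnat := component_appl_map χ A (p.toTop (f x)) γ
  rw [hf] at hnat
  have hx := PartitionDual.toMap_map (p.toTop (f x)) (component χ A p γ) (x := x) (y := f x) rfl
  rw [← hx, ← hnat]
  exact toMap_component_const hf hΔ χ (PowersetDual.mem_carrier γ x) x

theorem component_eq_coneMulEquiv (γ : (Γ.obj p).1.obj A) :
    MulOpposite.op (component χ A p γ).1 = coneMulEquiv f γ.1 :=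
  eq_coneMulEquiv_iff.2 (toMap_component hf hΔ χ γ)

theorem mem_linkedPairs_iff_eq_coneMulEquiv
    {x : NormalCone (Powerset X) × (NormalCone (Partitions X))ᵐᵒᵖ} :
    x ∈ linkedPairs χ ↔ x.2 = coneMulEquiv f x.1 := by
  rw [mem_linkedPairs_iff]
  constructor
  · rintro ⟨A, p, γ, rfl⟩
    exact component_eq_coneMulEquiv hf hΔ χ γ
  · intro hx
    obtain ⟨A, p, hγ⟩ := hf.exists_mem x.1
    exact ⟨A, p, ⟨x.1, hγ⟩, Prod.ext rfl
      (hx.trans (component_eq_coneMulEquiv hf hΔ χ ⟨x.1, hγ⟩).symm)⟩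

end

section

variable {X : Type u} [Fact (4 ≤ ENat.card X)]

/-! ### The dual given by a permutation -/

namespace PermDual

open PartitionDual NormalDual

variable (f : Equiv.Perm X)

/-- The object of `N*Π(X)` which corresponds to the image of `A` under `f`. -/
noncomputable def obj (A : Powerset X) : NormalDual (Partitions X) :=
  (exists_subset_eq (A.image f)).choose

theorem subset_obj (A : Powerset X) : subset (obj f A) = A.image f :=
  (exists_subset_eq (A.image f)).choose_spec

theorem obj_injective : Function.Injective (obj f) := fun A B h =>
  Powerset.ext <| f.injective.image_injective <| congrArg Powerset.carrier <|
    (subset_obj f A).symm.trans ((congrArg subset h).trans (subset_obj f B))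

variable {f} {A B : Powerset X} {p q : Partitions X}

theorem subobjOf_obj_iff : SubobjOf (obj f A) (obj f B) ↔ SubobjOf A B := by
  rw [subobjOf_iff, subset_obj, subset_obj]
  exact Set.image_subset_image_iff f.injective

theorem exists_obj_eq (F : NormalDual (Partitions X)) : ∃ A, obj f A = F := by
  refine ⟨(subset F).image f.symm, subset_injective (Powerset.ext ?_)⟩
  rw [subset_obj]
  exact f.image_symm_image _

theorem symm_toMap_mem (σ : (obj f A).1.obj p) (x : X) :
    f.symm (PartitionCone.toMap σ.1 x) ∈ A.carrier := by
  have h := mem_subset σ x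
  rw [subset_obj] at h
  obtain ⟨a, ha, h⟩ := h
  rw [← h, f.symm_apply_apply]
  exact ha

/-- The transformation with values in `f '' A` given by a function from the blocks of `p` to `A`. -/
def blockSing (f : Equiv.Perm X) (b : Quotient p.rel → A.carrier) : Sing X :=
  ⟨fun x => f (b (Quotient.mk _ x)),
    fun h => by
      obtain ⟨x, y, hxy, hp⟩ := p.exists_ne_rel
      exact hxy (h (congrArg (fun z => (f (b z) : X)) (Quotient.sound (s := p.rel) hp))),
    fun h => A.ne_univ <| Set.eq_univ_of_forall fun y => by
      obtain ⟨x, hx⟩ := h (f y)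
      exact f.injective hx ▸ (b (Quotient.mk _ x)).2⟩

theorem ofSing_blockSing_mem (b : Quotient p.rel → A.carrier) :
    PartitionCone.ofSing (blockSing f b) ∈ (obj f A).1.obj p := by
  rw [mem_iff, PartitionCone.toMap_ofSing, subset_obj]
  refine ⟨Set.range_subset_iff.2 fun x => ⟨_, (b _).2, rfl⟩, fun x y h => ?_⟩
  exact congrArg (fun z => f (b z)) (Quotient.sound (s := p.rel) h)

/-- The cones in the set `obj f A` at `p` correspond to the functions from the blocks of `p` to
`A`. -/
noncomputable def objEquiv (f : Equiv.Perm X) (A : Powerset X) (p : Partitions X) :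
    (obj f A).1.obj p ≃ (Quotient p.rel → A.carrier) where
  toFun σ := Quotient.lift (fun x => ⟨f.symm (PartitionCone.toMap σ.1 x), symm_toMap_mem σ x⟩)
    fun _ _ h => Subtype.ext (congrArg f.symm (toMap_eq_of_rel σ h))
  invFun b := ⟨PartitionCone.ofSing (blockSing f b), ofSing_blockSing_mem b⟩
  left_inv σ := Subtype.ext <| PartitionCone.toMap_injective <| by
    rw [PartitionCone.toMap_ofSing]
    exact funext fun x => f.apply_symm_apply _
  right_inv b := funext <| Quotient.ind fun x => Subtype.ext <|
    (congrArg f.symm (congrFun (PartitionCone.toMap_ofSing _) x)).trans (f.symm_apply_apply _)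

theorem apply_objEquiv (σ : (obj f A).1.obj p) (x : X) :
    f (objEquiv f A p σ (Quotient.mk _ x)) = PartitionCone.toMap σ.1 x :=
  f.apply_symm_apply _

theorem objEquiv_map (k : p ⟶ q) (σ : (obj f A).1.obj p) :
    objEquiv f A q ((obj f A).1.map k σ) = objEquiv f A p σ ∘ Partitions.toFun k := by
  refine funext <| Quotient.ind fun x => Subtype.ext (f.injective ?_)
  obtain ⟨y, hy⟩ := Quotient.exists_rep (Partitions.toFun k (Quotient.mk _ x))
  rw [apply_objEquiv, toMap_map k σ hy.symm, Function.comp_apply, ← hy, apply_objEquiv]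

theorem hom_ext_objEquiv {F : NormalDual (Partitions X)} {s t : F ⟶ obj f A}
    (h : ∀ p σ, objEquiv f A p (appl s p σ) = objEquiv f A p (appl t p σ)) : s = t :=
  hom_ext fun p σ => (objEquiv f A p).injective (h p σ)

/-- The morphism of `N*Π(X)` given by a function from `A` to `B`. -/
noncomputable def map (f : Equiv.Perm X) (g : A ⟶ B) : obj f A ⟶ obj f B :=
  homMk (fun p σ => (objEquiv f B p).symm (Powerset.toFun g ∘ objEquiv f A p σ)) fun k σ => by
    rw [Equiv.symm_apply_eq, objEquiv_map, objEquiv_map, Equiv.apply_symm_apply]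
    rfl

theorem objEquiv_appl_map (g : A ⟶ B) (σ : (obj f A).1.obj p) :
    objEquiv f B p (appl (map f g) p σ) = Powerset.toFun g ∘ objEquiv f A p σ :=
  Equiv.apply_symm_apply _ _

theorem toMap_appl_map (g : A ⟶ B) {σ : (obj f A).1.obj p} {x : X} {a : A.carrier}
    (h : PartitionCone.toMap σ.1 x = f a) :
    PartitionCone.toMap (appl (map f g) p σ).1 x = f (Powerset.toFun g a) := by
  have ha : objEquiv f A p σ (Quotient.mk _ x) = a :=
    Subtype.ext (f.injective ((apply_objEquiv σ x).trans h))
  rw [← apply_objEquiv, objEquiv_appl_map, Function.comp_apply, ha]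

theorem map_incl (h : SubobjOf A B) : map f (incl h) = incl (subobjOf_obj_iff.2 h) :=
  hom_ext_toMap fun _ σ x =>
    (toMap_appl_map (incl h) (apply_objEquiv σ x).symm).trans (apply_objEquiv σ x)

/-- The functor from `P(X)` to `N*Π(X)` which sends a subset to its image under `f`. -/
noncomputable def functor (f : Equiv.Perm X) : Powerset X ⥤ NormalDual (Partitions X) where
  obj := obj f
  map := map f
  map_id A := hom_ext_objEquiv fun p σ => objEquiv_appl_map (𝟙 A) σ
  map_comp g k := hom_ext_objEquiv fun p σ => by
    rw [objEquiv_appl_map, appl_comp, objEquiv_appl_map, objEquiv_appl_map]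
    rfl

theorem exists_map_eq (t : obj f A ⟶ obj f B) : ∃ g, map f g = t := by
  let κ (a : A.carrier) := (objEquiv f A Partitions.top).symm fun _ => a
  obtain ⟨x₀⟩ := (inferInstance : Nonempty X)
  let g : A ⟶ B := fun a => objEquiv f B _ (appl t _ (κ a)) (Quotient.mk _ x₀)
  refine ⟨g, hom_ext_objEquiv fun p σ => funext <| Quotient.ind fun x => ?_⟩
  have hκ : κ (objEquiv f A p σ (Quotient.mk _ x)) = (obj f A).1.map (p.toTop x) σ := by
    rw [Equiv.symm_apply_eq, objEquiv_map]
    rfl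
  rw [objEquiv_appl_map]
  change objEquiv f B _ (appl t _ (κ (objEquiv f A p σ (Quotient.mk _ x)))) (Quotient.mk _ x₀) = _
  rw [hκ, appl_map, objEquiv_map]
  rfl

theorem map_injective : Function.Injective (map f : (A ⟶ B) → (obj f A ⟶ obj f B)) := by
  intro g k h
  funext a
  let κ := (objEquiv f A Partitions.top).symm fun _ => a
  obtain ⟨x₀⟩ := (inferInstance : Nonempty X)
  have hκ : Powerset.toFun g ∘ objEquiv f A _ κ = Powerset.toFun k ∘ objEquiv f A _ κ := by
    rw [← objEquiv_appl_map, h, objEquiv_appl_map]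
  rw [Equiv.apply_symm_apply] at hκ
  exact congrFun hκ (Quotient.mk _ x₀)

theorem isLocalIso (f : Equiv.Perm X) : IsLocalIso (functor f) where
  map_incl h := ⟨subobjOf_obj_iff.2 h, map_incl h⟩
  full := ⟨exists_map_eq⟩
  faithful := ⟨fun h => map_injective h⟩
  ideal A := by
    refine ⟨fun B => subobjOf_obj_iff.2, (obj_injective f).injOn, fun F hF => ?_⟩
    obtain ⟨B, rfl⟩ := exists_obj_eq (f := f) F
    exact ⟨B, subobjOf_obj_iff.1 hF, rfl⟩

variable {Γ : Partitions X ⥤ NormalDual (Powerset X)} [Γ.Faithful] (hf : IsInducedBy Γ f)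
include hf

theorem isDualOf : IsDualOf (functor f) Γ := by
  have hMSet (A : Powerset X) (p : Partitions X) :
      A ∈ MSet (Γ.obj p) ↔ p ∈ MSet ((functor f).obj A) := by
    rw [hf.mem_MSet_iff, PartitionDual.mem_MSet_iff]
    exact iff_of_eq (congrArg (IsTransversal p.rel ·.carrier) (subset_obj f A).symm)
  refine ⟨⟨isLocalIso f, fun p => ?_⟩, hMSet⟩
  obtain ⟨A, hA⟩ := (Γ.obj p).gen.exists_isIso
  exact ⟨A, (hMSet A p).1 ⟨_, (Γ.obj p).eq_H, hA⟩⟩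

/-- The bijection from `Γ(A, p)` to `obj f A` at `p` given by conjugation by `f`. -/
noncomputable def conjEquiv (A : Powerset X) (p : Partitions X) :
    (Γ.obj p).1.obj A ≃ (obj f A).1.obj p :=
  ((coneMulEquiv f).toEquiv.trans MulOpposite.opEquiv.symm).subtypeEquiv
    fun _ => hf.mem_obj_iff (subset_obj f A)

theorem toMap_conjEquiv (γ : (Γ.obj p).1.obj A) (x : X) :
    PartitionCone.toMap (conjEquiv hf A p γ).1 (f x) = f (PowersetCone.toMap γ.1 x) :=
  toMap_coneMulEquiv f γ.1 x

/-- The duality between `Γ` and the functor given by `f`: conjugation by `f`. -/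
noncomputable def duality : bifunctor Γ ≅ dualBifunctor (functor f) :=
  dualityMk (conjEquiv hf) fun {A B p q} g k γ => by
    refine Subtype.ext (PartitionCone.toMap_injective (funext (f.surjective.forall.2 fun x => ?_)))
    obtain ⟨z, hz⟩ := Quotient.exists_rep (Partitions.toFun k (Quotient.mk _ (f x)))
    obtain ⟨y, rfl⟩ := f.surjective z
    calc PartitionCone.toMap
          (conjEquiv hf B q (appl (Γ.map k) B ((Γ.obj p).1.map g γ))).1 (f x)
      _ = f (Powerset.toFun g ⟨_, PowersetDual.mem_carrier γ y⟩) := by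
        rw [toMap_conjEquiv, hf.toMap_appl_map k hz.symm, PowersetDual.toMap_map]
      _ = PartitionCone.toMap (appl (map f g) p (conjEquiv hf A p γ)).1 (f y) :=
        (toMap_appl_map g (toMap_conjEquiv hf γ y)).symm
      _ = PartitionCone.toMap ((obj f B).1.map k (appl (map f g) p (conjEquiv hf A p γ))).1
          (f x) := (toMap_map k _ hz.symm).symm

end PermDual

end

/-! ### Sets with two elements -/

section

variable {X : Type u} [Nontrivial X]

theorem card_eq_two_or_four_le (hX : Nat.card X ≠ 3) : Nat.card X = 2 ∨ 4 ≤ ENat.card X := by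
  cases finite_or_infinite X
  · have hcard := Finite.one_lt_card (α := X)
    rw [ENat.card_eq_coe_natCard]
    norm_cast
    lia
  · exact Or.inr (by simp)

end

section

variable {X : Type u} [hX : Fact (Nat.card X = 2)]

namespace TwoElements

open NormalDual

instance : Nontrivial X :=
  have : Finite X := Nat.finite_of_card_ne_zero (by simp [hX.out])
  Finite.one_lt_card_iff_nontrivial.1 (by simp [hX.out])

theorem eq_or_eq {a b : X} (hab : a ≠ b) (x : X) : x = a ∨ x = b :=
  or_iff_not_imp_left.2 fun hx => ((Nat.card_eq_two_iff' a).1 hX.out).unique hx hab.symm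

theorem rel_eq_top (p : Partitions X) : p.rel = ⊤ := by
  obtain ⟨a, b, hab, h⟩ := p.exists_ne_rel
  have ha (x : X) : p.rel x a := by
    rcases eq_or_eq hab x with rfl | rfl
    exacts [p.rel.refl _, p.rel.symm h]
  exact top_le_iff.1 fun x y _ => p.rel.trans (ha x) (p.rel.symm (ha y))

instance : Subsingleton (Partitions X) :=
  ⟨fun p q => Partitions.ext ((rel_eq_top p).trans (rel_eq_top q).symm)⟩

instance (p : Partitions X) : Subsingleton (Quotient p.rel) :=
  ⟨Quotient.ind₂ fun _ _ => Quotient.sound (by rw [rel_eq_top]; trivial)⟩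

instance (p q : Partitions X) : Subsingleton (p ⟶ q) :=
  inferInstanceAs (Subsingleton (Quotient q.rel → Quotient p.rel))

instance : Subsingleton (NormalCone (Partitions X)) where
  allEq σ τ := by
    have hvertex : SubobjOf σ.vertex τ.vertex :=
      Subsingleton.elim τ.vertex σ.vertex ▸ SubobjectCategory.refl _
    exact NormalCone.ext_of_app_incl hvertex (SubobjectCategory.refl _)
      fun _ => Subsingleton.elim _ _

instance (F G : NormalDual (Partitions X)) : Subsingleton (F ⟶ G) :=
  ⟨fun _ _ => hom_ext fun _ _ => Subsingleton.elim _ _⟩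

instance : Subsingleton (NormalDual (Partitions X)) :=
  ⟨fun F G => Subtype.ext (by rw [F.eq_H, G.eq_H, Subsingleton.elim F.gen G.gen])⟩

instance : Nonempty (NormalDual (Partitions X)) := by
  obtain ⟨e, -⟩ := (Partitions.top (X := X)).exists_isIdempotentElem_ker_eq
  exact ⟨H (PartitionCone.ofSing e), _, Subsingleton.elim _ _, rfl⟩

theorem carrier_subsingleton (A : Powerset X) : A.carrier.Subsingleton := by
  intro a ha b hb
  by_contra hab
  refine A.ne_univ (Set.eq_univ_of_forall fun x => ?_)
  rcases eq_or_eq hab x with rfl | rfl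
  exacts [ha, hb]

instance (A : Powerset X) : Subsingleton A.carrier := (carrier_subsingleton A).coe_sort

instance (A B : Powerset X) : Subsingleton (A ⟶ B) :=
  inferInstanceAs (Subsingleton (A.carrier → B.carrier))

instance (F : NormalDual (Powerset X)) (A : Powerset X) : Subsingleton (F.1.obj A) where
  allEq γ δ := Subtype.ext <| PowersetCone.toMap_injective <| funext fun x =>
    carrier_subsingleton A (PowersetDual.mem_carrier γ x) (PowersetDual.mem_carrier δ x)

theorem eq_of_subobjOf {A B : Powerset X} (h : SubobjOf A B) : A = B := by
  obtain ⟨a, ha⟩ := A.nonempty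
  exact Powerset.ext (Set.Subset.antisymm h fun b hb => carrier_subsingleton B (h ha) hb ▸ ha)

variable (F : NormalDual (Partitions X))

theorem gen_mem (p : Partitions X) : F.gen ∈ F.1.obj p :=
  Subsingleton.elim F.gen.vertex p ▸ F.gen_mem

theorem mem_MSet_partitions (p : Partitions X) : p ∈ MSet F := by
  obtain ⟨q, hq⟩ := F.gen.exists_isIso
  exact ⟨F.gen, F.eq_H, Subsingleton.elim q p ▸ hq⟩

theorem mem_MSet_powerset (G : NormalDual (Powerset X)) (A : Powerset X) : A ∈ MSet G := by
  rw [PowersetDual.mem_MSet_iff, rel_eq_top]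
  obtain ⟨a, ha⟩ := A.nonempty
  exact fun _ => ⟨a, ⟨ha, trivial⟩, fun _ hb => carrier_subsingleton A hb.1 ha⟩

theorem isLocalIso_const : IsLocalIso ((Functor.const (Powerset X)).obj F) where
  map_incl _ := ⟨SubobjectCategory.refl F, Subsingleton.elim _ _⟩
  full := ⟨fun {_ B} _ => ⟨fun _ => ⟨_, B.nonempty.choose_spec⟩, Subsingleton.elim _ _⟩⟩
  faithful := ⟨fun _ => Subsingleton.elim _ _⟩
  ideal A := ⟨fun _ _ => SubobjectCategory.refl F,
    fun _ hB _ hB' _ => (eq_of_subobjOf hB).trans (eq_of_subobjOf hB').symm,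
    fun _ _ => ⟨A, SubobjectCategory.refl A, Subsingleton.elim _ _⟩⟩

variable (Γ : Partitions X ⥤ NormalDual (Powerset X))

theorem isDualOf_const : IsDualOf ((Functor.const (Powerset X)).obj F) Γ where
  isCrossConnection := ⟨isLocalIso_const F,
    fun p => ⟨Powerset.point (Classical.arbitrary X), mem_MSet_partitions F p⟩⟩
  mem_MSet_iff A p := iff_of_true (mem_MSet_powerset (Γ.obj p) A) (mem_MSet_partitions F p)

/-- The duality between `Γ` and a constant functor, all of whose components are the unique maps
between one-point sets. -/
noncomputable def dualityConst : bifunctor Γ ≅ dualBifunctor ((Functor.const (Powerset X)).obj F) :=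
  dualityMk
    (fun A p => equivOfSubsingletonOfSubsingleton (fun _ => ⟨F.gen, gen_mem F p⟩)
      fun _ => ⟨_, PowersetDual.const_mem (Γ.obj p) A.nonempty.choose_spec⟩)
    fun _ _ _ => Subsingleton.elim _ _

variable {F Γ}

theorem mem_linkedPairs {Δ : Powerset X ⥤ NormalDual (Partitions X)}
    (χ : bifunctor Γ ≅ dualBifunctor Δ)
    (x : NormalCone (Powerset X) × (NormalCone (Partitions X))ᵐᵒᵖ) : x ∈ linkedPairs χ := by
  have hx : x.1 ∈ (Γ.obj Partitions.top).1.obj x.1.vertex :=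
    PowersetDual.mem_iff.2 ⟨(PowersetCone.range_toMap _).subset, fun y z _ =>
      carrier_subsingleton _ (PowersetCone.toMap_mem x.1 y) (PowersetCone.toMap_mem x.1 z)⟩
  exact mem_linkedPairs_iff.2 ⟨_, _, ⟨x.1, hx⟩, Prod.ext rfl (Subsingleton.elim _ _)⟩

end TwoElements

end

end CrossConnection

open CrossConnection in
theorem mainTheorem3 (X : Type u) [Nontrivial X] (hX : Nat.card X ≠ 3)
    (Γ : Partitions X ⥤ NormalDual (Powerset X)) (hΓ : IsCrossConnection Γ) :
    (∃ Δ : Powerset X ⥤ NormalDual (Partitions X),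
      IsDualOf Δ Γ ∧ Nonempty (bifunctor Γ ≅ dualBifunctor Δ)) ∧
    ∀ (Δ : Powerset X ⥤ NormalDual (Partitions X)) (_ : IsDualOf Δ Γ)
      (χ : bifunctor Γ ≅ dualBifunctor Δ),
      ∃ S : Subsemigroup (NormalCone (Powerset X) × (NormalCone (Partitions X))ᵐᵒᵖ),
        (S : Set (NormalCone (Powerset X) × (NormalCone (Partitions X))ᵐᵒᵖ)) = linkedPairs χ ∧
        Nonempty (S ≃* Sing X) := by
  rcases card_eq_two_or_four_le hX with h2 | h4
  · have : Fact (Nat.card X = 2) := ⟨h2⟩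
    obtain ⟨F⟩ := (inferInstance : Nonempty (NormalDual (Partitions X)))
    refine ⟨⟨_, TwoElements.isDualOf_const F Γ, ⟨TwoElements.dualityConst F Γ⟩⟩, fun Δ _ χ => ?_⟩
    let θ : NormalCone (Powerset X) →ₙ* (NormalCone (Partitions X))ᵐᵒᵖ :=
      ⟨fun _ => .op F.gen, fun _ _ => Subsingleton.elim _ _⟩
    exact exists_subsemigroup_mulEquiv_sing θ fun x =>
      iff_of_true (TwoElements.mem_linkedPairs χ x) (Subsingleton.elim _ _)
  · have : Fact (4 ≤ ENat.card X) := ⟨h4⟩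
    have := hΓ.isLocalIso.faithful
    obtain ⟨f, hf⟩ := hΓ.exists_perm
    refine ⟨⟨_, PermDual.isDualOf hf, ⟨PermDual.duality hf⟩⟩, fun Δ hΔ χ => ?_⟩
    exact exists_subsemigroup_mulEquiv_sing (coneMulEquiv f : _ →ₙ* _) fun x =>
      mem_linkedPairs_iff_eq_coneMulEquiv hf hΔ χ
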